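/- A \emph{VASS} $V$ of dimension $n=\dim(V)$ consists of a finite set $\mathrm{Locs}(V)$ of locations and a finite set $\mathrm{Trns}(V)\subseteq \mathrm{Locs}(V)\times\mathbb{Z}^n\times \mathrm{Locs}(V)$ of transitions. Its states are the pairs $(l,\nu)\in \mathrm{Locs}(V)\times\mathbb{N}^n$. A step leads from $(l,\nu)$ to $(l',\nu+d)$, where $(l,d,l')\in \mathrm{Trns}(V)$ and $\nu+d\ge 0$. A trace is a sequence of consecutive steps; $V$ is terminating if it has no infinite trace. $V$ is connected if there is a (possibly empty) path of transitions from every location to every location. The SCCs of $V$ are its maximal connected sub-VASSs (a single location without transitions may be one). $V$ is conservative if the entries of every update $d$ add up to $0$. A state $(l,\nu)$ is $N$-bounded if $\nu(i)\le N$ for all $i$, and $\mathrm{comp}_N(V)$ is the length (number of steps) of the longest trace that starts in an $N$-bounded state. For $t\in \mathrm{Trns}(V)$ let $(B_t)$ be the system, in the unknowns $r\in\mathbb{Z}^n$, $z\in\mathbb{Z}^{\mathrm{Locs}(V)}$ with $r,z\ge 0$, that consists of $r^T d+z(l')-z(l)\le 0$ for all $(l,d,l')\in \mathrm{Trns}(V)$,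 with strict inequality for $t$. Let $(A_t)$ be the system, in the unknown $\mu\in\mathbb{Z}^{\mathrm{Trns}(V)}$ with $\mu\ge 0$, that consists of $\sum_{t'=(l,d,l')}\mu(t')\,d\ge 0$, of the condition that at every location the total $\mu$-weight of the incoming transitions equals that of the outgoing ones, and of $\mu(t)\ge 1$. The procedure $\mathrm{ranking}(V)$ takes a connected VASS $V$. If $\mathrm{Trns}(V)=\emptyset$, it returns the function that maps every state to the empty sequence. Otherwise let $T$ be the set of transitions $t$ for which $(B_t)$ is solvable. If $T=\emptyset$, it returns the non-termination witness $\sum_t \mu_t$, where $\mu_t$ is a solution of $(A_t)$. If $T\ne\emptyset$, it chooses solutions $(r_t,z_t)$ of $(B_t)$ for $t\in T$, sets $q(l,\nu)=\sum_{t\in T}(r_t^T\nu+z_t(l))$, and calls itself on every SCC $S$ of $V'=(\mathrm{Locs}(V),\mathrm{Trns}(V)\setminus T)$. If some call returns a non-termination witness, so does $\mathrm{ranking}(V)$. Otherwise the calls return functions $\mathrm{rank}_S$, and $\mathrm{ranking}(V)$ returns $\mathrm{rank}(l,\nu)=\langle q(l,\nu)\rangle\oplus \mathrm{rank}_S(l,\nu)$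 for $l\in \mathrm{Locs}(S)$, where $\oplus$ is concatenation. For finite sequences over $\mathbb{N}$ write $x>_{\mathrm{lex}}y$ if there is a position $i$ that exists in both sequences such that $x_i>y_i$ and $x_j=y_j$ for all $j<i$. A function $\mathrm{rank}$ from states to finite sequences over $\mathbb{N}$ is a lexicographic ranking function for $V$ if it decreases with respect to $>_{\mathrm{lex}}$ in every step of $V$ and its values have bounded length. Its order is the maximal length of its values (the least $k\ge 0$ such that all values have length at most $k$). \textbf{Statement.} Let $V$ be a connected conservative VASS. (1) If (for some choice of the solutions) $\mathrm{ranking}(V)$ returns a function $\mathrm{rank}$ of order $k$ on the states of $V$, rather than a non-termination witness, then $\mathrm{rank}$ is a lexicographic ranking function for $V$, $0\le k\le\dim(V)$, $\mathrm{comp}_N(V)$ is finite for every $N$, and $\mathrm{comp}_N(V)\in\Theta(N^k)$ as $N\to\infty$ if $k\ge 1$, while $\mathrm{comp}_N(V)=0$ for all $N$ if $k=0$. (2) Consequently, if $V$ is terminating, then there is an integer $k$ with $0\le k\le\dim(V)$ such that $\mathrm{ranking}(V)$ returns a lexicographic ranking function of order $k$, $\mathrm{comp}_N(V)$ is finite for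 every $N$, and $\mathrm{comp}_N(V)\in\Theta(N^k)$ as $N\to\infty$ if $k\ge 1$, while $\mathrm{comp}_N(V)=0$ for all $N$ if $k=0$. -/

import Mathlib

open Filter Asymptotics

/-- Transitions `l₁ --d--> l₂`, as triples `(l₁, d, l₂)`, with updates in `ℤ^n`. -/
abbrev Transition (L : Type*) (n : ℕ) := L × (Fin n → ℤ) × L

namespace Transition

variable {L : Type*} {n : ℕ}

/-- The source location. -/
def src (t : Transition L n) : L := t.1

/-- The update vector. -/
def update (t : Transition L n) : Fin n → ℤ := t.2.1

/-- The target location. -/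
def tgt (t : Transition L n) : L := t.2.2

end Transition

/-- States `(l, ν)`. The states of a VASS `V` are those with `l ∈ V.locs`. -/
abbrev VState (L : Type*) (n : ℕ) := L × (Fin n → ℕ)

/-- A vector addition system with states of dimension `n`: a finite set of locations (taken from
an ambient type `L`, so that sub-VASSs are again terms of this type) and a finite set of
transitions between them. -/
structure VASS (L : Type*) (n : ℕ) where
  locs : Finset L
  trns : Finset (Transition L n)
  src_mem : ∀ t ∈ trns, t.src ∈ locs
  tgt_mem : ∀ t ∈ trns, t.tgt ∈ locs

/-- What the procedure `ranking` returns: either "termination witnessed by `rank`" or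
"non-termination witnessed by `w`". -/
inductive RankingResult (L : Type*) (n : ℕ) where
  | terminating (rank : VState L n → List ℕ) : RankingResult L n
  | nonterminating (w : Transition L n → ℕ) : RankingResult L n

namespace VASS

variable {L : Type*} {n : ℕ}

/-! ### Paths, sub-VASSs, strongly connected components -/

/-- There is a (possibly empty) path from `l` to `l'`. -/
def Reach (V : VASS L n) (l l' : L) : Prop :=
  Relation.ReflTransGen (fun a b => ∃ d, ((a, d, b) : Transition L n) ∈ V.trns) l l'

/-- Every location can be reached from every location. -/
def Connected (V : VASS L n) : Prop :=
  ∀ l ∈ V.locs, ∀ l' ∈ V.locs, V.Reach l l'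

/-- `S` is a sub-VASS of `V`. -/
def IsSub (S V : VASS L n) : Prop :=
  S.locs ⊆ V.locs ∧ S.trns ⊆ V.trns

/-- The strongly connected components of `V`: its maximal connected sub-VASSs. -/
def IsSCC (S V : VASS L n) : Prop :=
  S.IsSub V ∧ S.Connected ∧ ∀ S' : VASS L n, S'.IsSub V → S'.Connected → S.IsSub S' → S' = S

/-- `(Locs(V), Trns(V) \ T)`. -/
def removeTrns [DecidableEq L] (V : VASS L n) (T : Finset (Transition L n)) : VASS L n where
  locs := V.locs
  trns := V.trns \ T
  src_mem := fun t ht => V.src_mem t (Finset.mem_sdiff.mp ht).1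
  tgt_mem := fun t ht => V.tgt_mem t (Finset.mem_sdiff.mp ht).1

/-- The entries of every update add up to zero. -/
def Conservative (V : VASS L n) : Prop :=
  ∀ t ∈ V.trns, ∑ i, t.update i = 0

/-! ### Steps, traces, complexity -/

/-- The step `σ --d--> σ'`. -/
def Step (V : VASS L n) (σ : VState L n) (d : Fin n → ℤ) (σ' : VState L n) : Prop :=
  ((σ.1, d, σ'.1) : Transition L n) ∈ V.trns ∧ ∀ i, (σ'.2 i : ℤ) = (σ.2 i : ℤ) + d i

/-- There is no infinite trace. -/
def Terminating (V : VASS L n) : Prop :=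
  ¬ ∃ σ : ℕ → VState L n, ∀ i, ∃ d, V.Step (σ i) d (σ (i + 1))

/-- There is a trace of length `m` (that is, with `m` steps) from `σ₀`. -/
def HasTrace (V : VASS L n) (σ₀ : VState L n) (m : ℕ) : Prop :=
  ∃ σ : ℕ → VState L n, σ 0 = σ₀ ∧ ∀ i < m, ∃ d, V.Step (σ i) d (σ (i + 1))

/-- `σ` is an `N`-bounded state of `V`: its valuation has maximum norm at most `N`. -/
def IsBoundedState (V : VASS L n) (N : ℕ) (σ : VState L n) : Prop :=
  σ.1 ∈ V.locs ∧ ∀ i, σ.2 i ≤ N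

/-- `comp_N(V)`: the length of the longest trace from some `N`-bounded state, as an element of
`ℕ∞` (it is `⊤` iff there are arbitrarily long such traces). -/
noncomputable def comp (V : VASS L n) (N : ℕ) : ℕ∞ :=
  sSup {m : ℕ∞ | ∃ (σ₀ : VState L n) (k : ℕ), m = k ∧ V.IsBoundedState N σ₀ ∧ V.HasTrace σ₀ k}

/-! ### Lexicographic ranking functions -/

/-- The order `>_lex` on finite sequences: at some position that exists in both sequences the first
one is larger, and all earlier entries agree. (A proper prefix is not comparable.) -/
def LexGT (x y : List ℕ) : Prop :=
  ∃ (i : ℕ) (hx : i < x.length) (hy : i < y.length), y[i] < x[i] ∧ x.take i = y.take i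

/-- `rank` decreases with respect to `>_lex` in every step of `V`. -/
def IsLexRanking (V : VASS L n) (rank : VState L n → List ℕ) : Prop :=
  ∀ σ d σ', V.Step σ d σ' → LexGT (rank σ) (rank σ')

/-- `rank` has order `k` on the states of `V`: `k` is the least number such that `rank` maps these
states to sequences of length at most `k`. -/
def HasOrder (V : VASS L n) (rank : VState L n → List ℕ) (k : ℕ) : Prop :=
  IsLeast {j : ℕ | ∀ l ∈ V.locs, ∀ ν, (rank (l, ν)).length ≤ j} k

/-! ### The two constraint systems and the procedure `ranking` -/

/-- `μ` solves `(A_t)`: `D μ ≥ 0`, `μ ≥ 0`, `F μ = 0`, `μ(t) ≥ 1`. Vectors indexed by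
`Trns(V)` are extended by zero. -/
def SolvesA [DecidableEq L] (V : VASS L n) (t : Transition L n) (μ : Transition L n → ℕ) : Prop :=
  (∀ t' ∉ V.trns, μ t' = 0) ∧
  (∀ i, 0 ≤ ∑ t' ∈ V.trns, t'.update i * (μ t' : ℤ)) ∧
  (∀ l ∈ V.locs, ∑ t' ∈ V.trns with t'.tgt = l, μ t' = ∑ t' ∈ V.trns with t'.src = l, μ t') ∧
  1 ≤ μ t

/-- `(r, z)` solves `(B_t)`: `r ≥ 0`, `z ≥ 0` and `Dᵀ r + Fᵀ z ≤ 0`, strictly in line `t`;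
here `(Fᵀ z)(t') = z(l') - z(l)` for `t' = (l, d, l')`. -/
def SolvesB (V : VASS L n) (t : Transition L n) (r : Fin n → ℕ) (z : L → ℕ) : Prop :=
  (∀ t' ∈ V.trns, ∑ i, t'.update i * (r i : ℤ) + ((z t'.tgt : ℤ) - (z t'.src : ℤ)) ≤ 0) ∧
  ∑ i, t.update i * (r i : ℤ) + ((z t.tgt : ℤ) - (z t.src : ℤ)) < 0

/-- `affine(r, z)(l, ν) = rᵀ ν + z(l)`. -/
def affineRank (r : Fin n → ℕ) (z : L → ℕ) (σ : VState L n) : ℕ :=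
  ∑ i, r i * σ.2 i + z σ.1

/-- `T` is the set of the transitions `t` of `V` for which `(B_t)` is solvable, and it is not
empty; `qrank` is the sum over `t ∈ T` of the functions `affine(r_t, z_t)` for some solutions
`(r_t, z_t)` of `(B_t)`. -/
def QuasiRankStage (V : VASS L n) (T : Finset (Transition L n)) (qrank : VState L n → ℕ) : Prop :=
  (∀ t, t ∈ T ↔ t ∈ V.trns ∧ ∃ r z, V.SolvesB t r z) ∧ T.Nonempty ∧
  ∃ (r : Transition L n → Fin n → ℕ) (z : Transition L n → L → ℕ),
    (∀ t ∈ T, V.SolvesB t (r t) (z t)) ∧ ∀ σ, qrank σ = ∑ t ∈ T, affineRank (r t) (z t) σ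

/-- `Ranking V res`: the procedure `ranking`, run on `V`, can return `res`. It is a relation,
because the procedure is free in the choice of the solutions of the constraint systems (and in the
order in which it goes through the components). -/
inductive Ranking [DecidableEq L] : VASS L n → RankingResult L n → Prop
  /-- There are no transitions: the constant empty sequence is returned. -/
  | noTransitions (V : VASS L n) (hV : V.trns = ∅) :
      Ranking V (.terminating fun _ => [])
  /-- There are transitions, but no system `(B_t)` is solvable: the sum of solutions of the systems
  `(A_t)` is returned. -/
  | noDecrease (V : VASS L n) (hV : V.trns.Nonempty)
      (hB : ∀ t ∈ V.trns, ¬ ∃ r z, V.SolvesB t r z)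
      (μ : Transition L n → Transition L n → ℕ) (hμ : ∀ t ∈ V.trns, V.SolvesA t (μ t)) :
      Ranking V (.nonterminating fun t' => ∑ t ∈ V.trns, μ t t')
  /-- Some recursive call returned a witness for non-termination. -/
  | recNonterminating (V : VASS L n) (T : Finset (Transition L n)) (qrank : VState L n → ℕ)
      (hT : V.QuasiRankStage T qrank) (S : VASS L n) (hS : S.IsSCC (V.removeTrns T))
      (w : Transition L n → ℕ) (hw : Ranking S (.nonterminating w)) :
      Ranking V (.nonterminating w)
  /-- All recursive calls returned ranking functions; `rank` is their combination with `qrank`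
  (the values of `rank` outside the states of `V` do not matter). -/
  | recTerminating (V : VASS L n) (T : Finset (Transition L n)) (qrank : VState L n → ℕ)
      (hT : V.QuasiRankStage T qrank) (rankS : VASS L n → VState L n → List ℕ)
      (hS : ∀ S : VASS L n, S.IsSCC (V.removeTrns T) → Ranking S (.terminating (rankS S)))
      (rank : VState L n → List ℕ)
      (hrank : ∀ S : VASS L n, S.IsSCC (V.removeTrns T) → ∀ l ∈ S.locs, ∀ ν,
        rank (l, ν) = qrank (l, ν) :: rankS S (l, ν)) :
      Ranking V (.terminating rank)

end VASS

/-! By Farkas' lemma, a transition `t` has a solution of exactly one of `(A_t)` and `(B_t)`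
(`exists_solvesB_or_exists_solvesA`, `SolvesA.not_solvesB`). Hence every transition outside `T` lies
in the support of a circulation that avoids `T`, so it lies on a cycle avoiding `T` and stays inside
its component (`mutualReach_of_mem_removeTrns`). A step in `T` lowers `q`; any other step does not
raise `q` and is ranked by the recursive call. This makes `rank` lexicographic.

Upper bound: conservativity keeps the sum of the counters fixed, so all entries of `rank` are `O(N)`
along a trace. Read as digits, they form a strictly decreasing number below `O(N)^k`
(`Conservative.lt_of_hasTrace`). The order is at most the dimension because the span of the effects
of circulations shrinks strictly at each recursion (`QuasiRankStage.cycleSpace_lt`).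

Lower bound (`Ranking.exists_long_walk`): conservativity turns `D μ ≥ 0` into `D μ = 0`, so some
circulation `μ` with total effect zero has support exactly the transitions outside `T`. Recursively,
each component executes its share of `μ` `N` times by a long closed walk with drop `O(N)`. Splicing
these walks into an Eulerian closed walk of the whole system adds no net effect. The result has
bounded net loss, so it can be repeated `N` times with drop still `O(N)`, and its length gains a
factor `N`.

For (2), the procedure always answers, and a non-termination witness yields an Eulerian closed walk
of nonnegative effect, which can be run forever. -/

/-- **Farkas' lemma** over an ordered field, for linear forms on an arbitrary vector space. -/
theorem exists_nonneg_combination_of_forall_nonpos {K W ι : Type*} [Field K] [LinearOrder K]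
    [IsStrictOrderedRing K] [AddCommGroup W] [Module K W] [DecidableEq ι] (s : Finset ι)
    (α : ι → W →ₗ[K] K) (γ : W →ₗ[K] K) (h : ∀ x, (∀ i ∈ s, α i x ≤ 0) → γ x ≤ 0) :
    ∃ u : ι → K, (∀ i, 0 ≤ u i) ∧ γ = ∑ i ∈ s, u i • α i := by
  induction s using Finset.induction_on generalizing α γ with
  | empty =>
    refine ⟨0, fun _ => le_rfl, ?_⟩
    ext x
    have h1 := h x (by simp)
    have h2 := h (-x) (by simp)
    simp only [map_neg] at h2
    simp only [Finset.sum_empty, LinearMap.zero_apply]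
    linarith
  | insert j s hj ih =>
    by_cases hs : ∀ x, (∀ i ∈ s, α i x ≤ 0) → γ x ≤ 0
    · obtain ⟨u, hu, hγ⟩ := ih α γ hs
      refine ⟨fun i => if i = j then 0 else u i, fun i => by
        beta_reduce; split_ifs <;> simp [hu], ?_⟩
      rw [Finset.sum_insert hj, hγ]
      simp only [if_true, zero_smul, zero_add]
      refine Finset.sum_congr rfl fun i hi => ?_
      rw [if_neg (ne_of_mem_of_not_mem hi hj)]
    · push Not at hs
      obtain ⟨x₀, hx₀, hγ₀⟩ := hs
      have hj₀ : 0 < α j x₀ := by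
        by_contra hc
        refine absurd (h x₀ fun i hi => ?_) (not_le.mpr hγ₀)
        rcases Finset.mem_insert.mp hi with rfl | hi
        · exact not_lt.mp hc
        · exact hx₀ i hi
      set a := α j x₀ with ha
      -- Projection along `x₀` onto the kernel of `α j`: the modified forms are the old ones
      -- evaluated at the projection of `x`, where the constraint `j` holds with equality.
      obtain ⟨u, hu, hγ⟩ := ih (fun i => α i - (α i x₀ / a) • α j) (γ - (γ x₀ / a) • α j) (by
        intro x hx
        have := h (x - (α j x / a) • x₀) (by
          intro i hi
          rcases Finset.mem_insert.mp hi with rfl | hi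
          · simp only [map_sub, map_smul, smul_eq_mul, ← ha]
            rw [div_mul_cancel₀ _ hj₀.ne', sub_self]
          · have := hx i hi
            simp only [LinearMap.sub_apply, LinearMap.smul_apply, smul_eq_mul] at this
            simp only [map_sub, map_smul, smul_eq_mul]
            calc _ = α i x - α i x₀ / a * α j x := by ring
              _ ≤ 0 := this)
        simp only [map_sub, map_smul, smul_eq_mul] at this
        simp only [LinearMap.sub_apply, LinearMap.smul_apply, smul_eq_mul]
        calc _ = γ x - α j x / a * γ x₀ := by ring
          _ ≤ 0 := this)
      refine ⟨fun i => if i = j then γ x₀ / a - ∑ i ∈ s, u i * (α i x₀ / a) else u i,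
        fun i => ?_, ?_⟩
      · beta_reduce
        split_ifs
        · have : ∑ i ∈ s, u i * (α i x₀ / a) ≤ 0 := Finset.sum_nonpos fun i hi =>
            mul_nonpos_of_nonneg_of_nonpos (hu i) (div_nonpos_of_nonpos_of_nonneg (hx₀ i hi) hj₀.le)
          have := div_pos hγ₀ hj₀
          linarith
        · exact hu i
      · beta_reduce
        rw [Finset.sum_insert hj, if_pos rfl, Finset.sum_congr rfl (g := fun i => u i • α i)
          (fun i hi => by rw [if_neg (ne_of_mem_of_not_mem hi hj)])]
        rw [sub_eq_iff_eq_add] at hγ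
        refine hγ.trans ?_
        ext x
        simp only [LinearMap.add_apply, LinearMap.sum_apply, LinearMap.smul_apply,
          LinearMap.sub_apply, smul_eq_mul, sub_mul, mul_sub, Finset.sum_sub_distrib,
          Finset.sum_mul]
        simp only [mul_assoc]
        ring

namespace VASS

variable {L : Type*} {n : ℕ}

/-- The total update `∑ μ(t) d` over the transitions `t = (l, d, l')` of `V`. -/
def totalUpdate (V : VASS L n) (μ : Transition L n → ℕ) (i : Fin n) : ℤ :=
  ∑ t ∈ V.trns, t.update i * (μ t : ℤ)

/-- `μ` is a circulation of `V`: it vanishes off the transitions, and at every location the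
incoming weight is the outgoing weight. -/
def Circulation [DecidableEq L] (V : VASS L n) (μ : Transition L n → ℕ) : Prop :=
  (∀ t ∉ V.trns, μ t = 0) ∧
  ∀ l, ∑ t ∈ V.trns with t.tgt = l, μ t = ∑ t ∈ V.trns with t.src = l, μ t

theorem ext_trns {S S' : VASS L n} (h : S.locs = S'.locs) (h' : S.trns = S'.trns) : S = S' := by
  cases S; cases S'; simp_all

/-! ### Reachability and strongly connected components -/

theorem Reach.mono {S V : VASS L n} (h : S.trns ⊆ V.trns) {a b : L} (hab : S.Reach a b) :
    V.Reach a b :=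
  Relation.ReflTransGen.mono (fun _ _ ⟨d, hd⟩ => ⟨d, h hd⟩) _ _ hab

theorem Reach.of_mem {V : VASS L n} {t : Transition L n} (ht : t ∈ V.trns) :
    V.Reach t.src t.tgt :=
  Relation.ReflTransGen.single ⟨t.update, ht⟩

theorem Reach.mem_locs {V : VASS L n} {a b : L} (hab : V.Reach a b) (ha : a ∈ V.locs) :
    b ∈ V.locs := by
  induction hab with
  | refl => exact ha
  | tail _ h _ => obtain ⟨d, hd⟩ := h; exact V.tgt_mem _ hd

theorem Reach.closed {V : VASS L n} {X : Set L} (hX : ∀ t ∈ V.trns, t.src ∈ X → t.tgt ∈ X)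
    {a b : L} (hab : V.Reach a b) (ha : a ∈ X) : b ∈ X := by
  induction hab with
  | refl => exact ha
  | tail _ h ih => obtain ⟨d, hd⟩ := h; exact hX _ hd ih

/-- Mutual reachability, as a setoid on locations. -/
def mutualReach (V : VASS L n) : Setoid L where
  r a b := V.Reach a b ∧ V.Reach b a
  iseqv :=
    { refl := fun _ => ⟨.refl, .refl⟩
      symm := fun h => ⟨h.2, h.1⟩
      trans := fun h h' => ⟨h.1.trans h'.1, h'.2.trans h.2⟩ }

open Classical in
/-- The strongly connected component of the location `l`. -/
noncomputable def sccOf (V : VASS L n) (l : L) : VASS L n where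
  locs := {x ∈ V.locs | V.mutualReach l x}
  trns := {t ∈ V.trns | V.mutualReach l t.src ∧ V.mutualReach l t.tgt}
  src_mem t ht := by
    rw [Finset.mem_filter] at ht ⊢
    exact ⟨V.src_mem t ht.1, ht.2.1⟩
  tgt_mem t ht := by
    rw [Finset.mem_filter] at ht ⊢
    exact ⟨V.tgt_mem t ht.1, ht.2.2⟩

theorem mem_sccOf_locs {V : VASS L n} {l x : L} :
    x ∈ (V.sccOf l).locs ↔ x ∈ V.locs ∧ V.mutualReach l x := by
  classical exact Finset.mem_filter

theorem mem_sccOf_trns {V : VASS L n} {l : L} {t : Transition L n} :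
    t ∈ (V.sccOf l).trns ↔ t ∈ V.trns ∧ V.mutualReach l t.src ∧ V.mutualReach l t.tgt := by
  classical exact Finset.mem_filter

theorem self_mem_sccOf {V : VASS L n} {l : L} (hl : l ∈ V.locs) : l ∈ (V.sccOf l).locs :=
  mem_sccOf_locs.mpr ⟨hl, V.mutualReach.refl l⟩

theorem sccOf_isSub (V : VASS L n) (l : L) : (V.sccOf l).IsSub V :=
  ⟨fun _ h => (mem_sccOf_locs.mp h).1, fun _ h => (mem_sccOf_trns.mp h).1⟩

theorem sccOf_connected (V : VASS L n) (l : L) : (V.sccOf l).Connected := by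
  intro a ha b hb
  replace ha := (mem_sccOf_locs.mp ha).2
  replace hb := (mem_sccOf_locs.mp hb).2
  have hab : V.Reach a b := ha.2.trans hb.1
  induction hab using Relation.ReflTransGen.head_induction_on with
  | refl => exact .refl
  | @head a c h hcb ih =>
    have hc : V.mutualReach l c := ⟨ha.1.tail h, hcb.trans hb.2⟩
    refine Relation.ReflTransGen.head ?_ (ih hc)
    obtain ⟨d, hd⟩ := h
    exact ⟨d, mem_sccOf_trns.mpr ⟨hd, ha, hc⟩⟩

theorem Connected.isSub_sccOf {S V : VASS L n} (hS : S.Connected) (hSV : S.IsSub V) {l : L}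
    (hl : l ∈ S.locs) : S.IsSub (V.sccOf l) := by
  have key : ∀ x ∈ S.locs, V.mutualReach l x := fun x hx =>
    ⟨(hS l hl x hx).mono hSV.2, (hS x hx l hl).mono hSV.2⟩
  exact ⟨fun x hx => mem_sccOf_locs.mpr ⟨hSV.1 hx, key x hx⟩, fun t ht => mem_sccOf_trns.mpr
    ⟨hSV.2 ht, key _ (S.src_mem t ht), key _ (S.tgt_mem t ht)⟩⟩

theorem isSCC_sccOf {V : VASS L n} {l : L} (hl : l ∈ V.locs) : (V.sccOf l).IsSCC V := by
  refine ⟨V.sccOf_isSub l, V.sccOf_connected l, fun S hS hc hsub => ?_⟩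
  have h := hc.isSub_sccOf hS (hsub.1 (self_mem_sccOf hl))
  exact ext_trns (h.1.antisymm hsub.1) (h.2.antisymm hsub.2)

theorem IsSCC.eq_sccOf {S V : VASS L n} (hS : S.IsSCC V) {l : L} (hl : l ∈ S.locs) :
    V.sccOf l = S :=
  hS.2.2 _ (V.sccOf_isSub l) (V.sccOf_connected l) (hS.2.1.isSub_sccOf hS.1 hl)

/-! ### Circulations -/

theorem totalUpdate_sum {V : VASS L n} {ι : Type*} (s : Finset ι) (μ : ι → Transition L n → ℕ)
    (i : Fin n) : V.totalUpdate (fun t => ∑ j ∈ s, μ j t) i = ∑ j ∈ s, V.totalUpdate (μ j) i := by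
  simp only [totalUpdate, Nat.cast_sum, Finset.mul_sum]
  exact Finset.sum_comm

theorem Conservative.sum_totalUpdate {V : VASS L n} (hV : V.Conservative)
    (μ : Transition L n → ℕ) : ∑ i, V.totalUpdate μ i = 0 := by
  simp only [totalUpdate]
  rw [Finset.sum_comm]
  refine Finset.sum_eq_zero fun t ht => ?_
  rw [← Finset.sum_mul, hV t ht, zero_mul]

variable [DecidableEq L]

/-- Summation by parts: regrouped by location, `z l` is multiplied by inflow minus outflow. -/
theorem Circulation.sum_potential {V : VASS L n} {μ : Transition L n → ℕ} (h : V.Circulation μ)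
    (z : L → ℤ) : ∑ t ∈ V.trns, (μ t : ℤ) * (z t.tgt - z t.src) = 0 := by
  have key : ∀ f : Transition L n → L, (∀ t ∈ V.trns, f t ∈ V.locs) →
      ∑ t ∈ V.trns, (μ t : ℤ) * z (f t) =
        ∑ l ∈ V.locs, ((∑ t ∈ V.trns with f t = l, μ t : ℕ) : ℤ) * z l := by
    intro f hf
    rw [← Finset.sum_fiberwise_of_maps_to hf]
    refine Finset.sum_congr rfl fun l _ => ?_
    push_cast
    rw [Finset.sum_mul]
    refine Finset.sum_congr rfl fun t ht => ?_
    rw [(Finset.mem_filter.mp ht).2]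
  simp only [mul_sub, Finset.sum_sub_distrib]
  rw [key _ V.tgt_mem, key _ V.src_mem, sub_eq_zero]
  exact Finset.sum_congr rfl fun l _ => by rw [h.2 l]

theorem Circulation.add {V : VASS L n} {μ μ' : Transition L n → ℕ} (h : V.Circulation μ)
    (h' : V.Circulation μ') : V.Circulation (fun t => μ t + μ' t) :=
  ⟨fun t ht => by simp [h.1 t ht, h'.1 t ht], fun l => by
    simp only [Finset.sum_add_distrib, h.2 l, h'.2 l]⟩

theorem Circulation.sum {V : VASS L n} {ι : Type*} (s : Finset ι) {μ : ι → Transition L n → ℕ}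
    (h : ∀ i ∈ s, V.Circulation (μ i)) : V.Circulation (fun t => ∑ i ∈ s, μ i t) := by
  refine ⟨fun t ht => Finset.sum_eq_zero fun i hi => (h i hi).1 t ht, fun l => ?_⟩
  rw [Finset.sum_comm, Finset.sum_comm (t := s)]
  exact Finset.sum_congr rfl fun i hi => (h i hi).2 l

theorem SolvesA.circulation {V : VASS L n} {t : Transition L n} {μ : Transition L n → ℕ}
    (h : V.SolvesA t μ) : V.Circulation μ := by
  refine ⟨h.1, fun l => ?_⟩
  by_cases hl : l ∈ V.locs
  · exact h.2.2.1 l hl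
  · rw [Finset.filter_false_of_mem, Finset.filter_false_of_mem]
    · exact fun t ht e => hl (e ▸ V.src_mem t ht)
    · exact fun t ht e => hl (e ▸ V.tgt_mem t ht)

/-- Nonnegative coordinates whose sum is zero must vanish. The lower bound needs conservativity for
exactly this. -/
theorem SolvesA.totalUpdate_eq_zero {V : VASS L n} (hV : V.Conservative) {t : Transition L n}
    {μ : Transition L n → ℕ} (h : V.SolvesA t μ) (i : Fin n) : V.totalUpdate μ i = 0 :=
  (Finset.sum_eq_zero_iff_of_nonneg fun i _ => h.2.1 i).mp (hV.sum_totalUpdate μ) i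
    (Finset.mem_univ i)

/-- The transitions in the support of a circulation lie on cycles of the support. -/
theorem Circulation.reach_tgt_src {V S : VASS L n} {μ : Transition L n → ℕ}
    (h : V.Circulation μ) (hS : ∀ t ∈ V.trns, μ t ≠ 0 → t ∈ S.trns) {t : Transition L n}
    (ht : μ t ≠ 0) : S.Reach t.tgt t.src := by
  classical
  have htV : t ∈ V.trns := by by_contra hc; exact ht (h.1 t hc)
  -- The potential is the indicator of the set reachable from `t.tgt`. No transition of the support
  -- leaves this set, so all summands are nonnegative; as they add up to zero, none enters it
  -- either, whereas `t` would if `t.src` were outside.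
  have h0 := h.sum_potential (fun x => if S.Reach t.tgt x then 1 else 0)
  have hn : ∀ t' ∈ V.trns, 0 ≤ (μ t' : ℤ) * ((if S.Reach t.tgt t'.tgt then 1 else 0) -
      (if S.Reach t.tgt t'.src then 1 else 0)) := by
    intro t' ht'
    by_cases hμ : μ t' = 0
    · simp [hμ]
    · have := Reach.of_mem (hS t' ht' hμ)
      refine mul_nonneg (by positivity) ?_
      split_ifs with h1 h2 h2
      · simp
      · simp
      · exact absurd (h2.trans this) h1
      · simp
  have := (Finset.sum_eq_zero_iff_of_nonneg hn).mp h0 t htV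
  by_contra hc
  rw [if_pos (show S.Reach t.tgt t.tgt from .refl), if_neg hc] at this
  simp at this
  exact ht this

/-- The rate of decrease of `affineRank r z` along `t`. -/
def descent (r : Fin n → ℕ) (z : L → ℕ) (t : Transition L n) : ℤ :=
  ∑ i, t.update i * (r i : ℤ) + ((z t.tgt : ℤ) - (z t.src : ℤ))

/-- The location part `z` is a potential and cancels, leaving only `r` against the total update. -/
theorem Circulation.sum_descent {V : VASS L n} {μ : Transition L n → ℕ} (h : V.Circulation μ)
    (r : Fin n → ℕ) (z : L → ℕ) :
    ∑ t ∈ V.trns, (μ t : ℤ) * descent r z t = ∑ i, V.totalUpdate μ i * (r i : ℤ) := by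
  simp only [descent, mul_add, Finset.sum_add_distrib]
  rw [h.sum_potential (fun l => (z l : ℤ)), add_zero]
  simp only [totalUpdate, Finset.sum_mul, Finset.mul_sum]
  rw [Finset.sum_comm]
  exact Finset.sum_congr rfl fun i _ => Finset.sum_congr rfl fun t _ => by ring

/-- Transitions in the support of a solution of `(A_t)` do not occur strictly in any `(B_t')`. -/
theorem SolvesA.not_solvesB {V : VASS L n} {t t' : Transition L n} {μ : Transition L n → ℕ}
    (h : V.SolvesA t μ) (ht' : μ t' ≠ 0) (r : Fin n → ℕ) (z : L → ℕ) : ¬ V.SolvesB t' r z := by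
  rintro ⟨h1, h2⟩
  have hs := h.circulation.sum_descent r z
  have htV : t' ∈ V.trns := by by_contra hc; exact ht' (h.1 t' hc)
  have h3 : 0 ≤ ∑ i, V.totalUpdate μ i * (r i : ℤ) :=
    Finset.sum_nonneg fun i _ => mul_nonneg (h.2.1 i) (by positivity)
  have h4 : ∑ t ∈ V.trns, (μ t : ℤ) * descent r z t < 0 :=
    Finset.sum_neg' (fun s hs => mul_nonpos_of_nonneg_of_nonpos (by positivity) (h1 s hs))
      ⟨t', htV, mul_neg_of_pos_of_neg (by positivity) h2⟩
  omega

end VASS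

/-! ### Integer solutions and the alternative between `(A_t)` and `(B_t)` -/

theorem exists_common_denominator (s : Finset ℚ) :
    ∃ D : ℕ, 0 < D ∧ ∀ x ∈ s, ∃ m : ℤ, (m : ℚ) = D * x := by
  refine ⟨∏ x ∈ s, x.den, Finset.prod_pos fun x _ => x.den_pos, fun x hx => ?_⟩
  refine ⟨(∏ y ∈ s.erase x, y.den : ℕ) * x.num, ?_⟩
  rw [← Finset.mul_prod_erase s _ hx]
  push_cast
  rw [← Rat.mul_den_eq_num]
  ring

namespace VASS

variable {L : Type*} {n : ℕ}

/-- The left-hand side of the line `t` of the system `(B)`, as a linear form. -/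
def lineForm (t : Transition L n) : (Fin n → ℚ) × (L → ℚ) →ₗ[ℚ] ℚ :=
  (∑ i, (t.update i : ℚ) • LinearMap.proj i) ∘ₗ LinearMap.fst ℚ _ _ +
    ((LinearMap.proj t.tgt : (L → ℚ) →ₗ[ℚ] ℚ) - LinearMap.proj t.src) ∘ₗ LinearMap.snd ℚ _ _

theorem lineForm_apply (t : Transition L n) (r : Fin n → ℚ) (z : L → ℚ) :
    lineForm t (r, z) = ∑ i, (t.update i : ℚ) * r i + (z t.tgt - z t.src) := by
  simp [lineForm]

/-- The system is homogeneous, so denominators can be cleared. No sign condition on `z` is needed,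
since only differences of `z` enter. -/
theorem exists_solvesB_of_rat {V : VASS L n} {t : Transition L n} (ht : t ∈ V.trns)
    {r : Fin n → ℚ} {z : L → ℚ} (hr : ∀ i, 0 ≤ r i)
    (h : ∀ t' ∈ V.trns, lineForm t' (r, z) ≤ 0) (h' : lineForm t (r, z) < 0) :
    ∃ r z, V.SolvesB t r z := by
  classical
  obtain ⟨D, hD, hint⟩ := exists_common_denominator
    (Finset.univ.image r ∪ V.locs.image z)
  have hr' : ∀ i, ∃ m : ℕ, (m : ℚ) = D * r i := by
    intro i
    obtain ⟨m, hm⟩ := hint (r i) (by simp)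
    have h0 : (0 : ℚ) ≤ m := hm ▸ mul_nonneg (by positivity) (hr i)
    refine ⟨m.toNat, ?_⟩
    rw [← hm, ← Int.cast_natCast, Int.toNat_of_nonneg (by exact_mod_cast h0)]
  have hz' : ∀ l, ∃ m : ℤ, l ∈ V.locs → (m : ℚ) = D * z l := by
    intro l
    by_cases hl : l ∈ V.locs
    · obtain ⟨m, hm⟩ := hint (z l)
        (Finset.mem_union_right _ (Finset.mem_image_of_mem _ hl))
      exact ⟨m, fun _ => hm⟩
    · exact ⟨0, fun h => absurd h hl⟩
  choose R hR using hr'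
  choose Z hZ using hz'
  -- A common shift that makes `Z` nonnegative on the finitely many locations.
  set c : ℤ := ∑ l ∈ V.locs, |Z l|
  have hc : ∀ l ∈ V.locs, ((Z l + c).toNat : ℤ) = Z l + c := by
    intro l hl
    have h1 : |Z l| ≤ c := Finset.single_le_sum (f := fun l => |Z l|)
      (fun _ _ => abs_nonneg _) hl
    have := neg_abs_le (Z l)
    exact Int.toNat_of_nonneg (by linarith)
  have key : ∀ t' ∈ V.trns, (((∑ i, t'.update i * (R i : ℤ) +
      (((Z t'.tgt + c).toNat : ℤ) - ((Z t'.src + c).toNat : ℤ)) : ℤ)) : ℚ) =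
      D * lineForm t' (r, z) := by
    intro t' ht'
    rw [hc _ (V.tgt_mem t' ht'), hc _ (V.src_mem t' ht'), lineForm_apply]
    push_cast
    rw [hZ _ (V.tgt_mem t' ht'), hZ _ (V.src_mem t' ht'), mul_add, Finset.mul_sum]
    simp only [hR]
    congr 1
    · exact Finset.sum_congr rfl fun i _ => by ring
    · ring
  have hDq : (0 : ℚ) < D := by exact_mod_cast hD
  refine ⟨R, fun l => (Z l + c).toNat, fun t' ht' => ?_, ?_⟩
  · have := key t' ht' ▸ mul_nonpos_of_nonneg_of_nonpos hDq.le (h t' ht')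
    exact_mod_cast this
  · have := key t ht ▸ mul_neg_of_pos_of_neg hDq h'
    exact_mod_cast this

variable [DecidableEq L]

theorem exists_solvesA_of_rat {V : VASS L n} {t : Transition L n} (ht : t ∈ V.trns)
    {u : Transition L n → ℚ} (hu : ∀ t', 0 ≤ u t') (hut : 0 < u t)
    (h : ∀ i, 0 ≤ ∑ t' ∈ V.trns, (t'.update i : ℚ) * u t')
    (h' : ∀ l, ∑ t' ∈ V.trns with t'.tgt = l, u t' = ∑ t' ∈ V.trns with t'.src = l, u t') :
    ∃ μ, V.SolvesA t μ := by
  classical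
  obtain ⟨D, hD, hint⟩ := exists_common_denominator (V.trns.image u)
  have hex : ∀ t', ∃ m : ℕ, (t' ∈ V.trns → (m : ℚ) = D * u t') ∧ (t' ∉ V.trns → m = 0) := by
    intro t'
    by_cases ht' : t' ∈ V.trns
    · obtain ⟨m, hm⟩ := hint (u t') (Finset.mem_image_of_mem _ ht')
      have h0 : (0 : ℚ) ≤ m := hm ▸ mul_nonneg (by positivity) (hu t')
      refine ⟨m.toNat, fun _ => ?_, fun hc => absurd ht' hc⟩
      rw [← hm, ← Int.cast_natCast, Int.toNat_of_nonneg (by exact_mod_cast h0)]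
    · exact ⟨0, fun hc => absurd hc ht', fun _ => rfl⟩
  choose μ hμ hμ0 using hex
  have hDq : (0 : ℚ) < D := by exact_mod_cast hD
  refine ⟨μ, hμ0, fun i => ?_, fun l _ => ?_, ?_⟩
  · have : ((∑ t' ∈ V.trns, t'.update i * (μ t' : ℤ) : ℤ) : ℚ) =
        D * ∑ t' ∈ V.trns, (t'.update i : ℚ) * u t' := by
      push_cast
      rw [Finset.mul_sum]
      exact Finset.sum_congr rfl fun t' ht' => by rw [hμ t' ht']; ring
    have := this ▸ mul_nonneg hDq.le (h i)
    exact_mod_cast this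
  · have key : ∀ p : Transition L n → Prop, ∀ [DecidablePred p],
        ((∑ t' ∈ V.trns with p t', μ t' : ℕ) : ℚ) = D * ∑ t' ∈ V.trns with p t', u t' := by
      intro p _
      push_cast
      rw [Finset.mul_sum]
      exact Finset.sum_congr rfl fun t' ht' => hμ t' (Finset.mem_filter.mp ht').1
    have := (key (fun t' => t'.tgt = l)).trans ((congrArg _ (h' l)).trans
      (key (fun t' => t'.src = l)).symm)
    exact_mod_cast this
  · have : (0 : ℚ) < μ t := hμ t ht ▸ mul_pos hDq hut
    exact_mod_cast this

/-- Farkas' lemma is applied to the line forms and the forms `-r i`, with target `-lineForm t`. A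
point violating the implication solves `(B_t)`; the multipliers of a valid one solve `(A_t)`. -/
theorem exists_solvesB_or_exists_solvesA {V : VASS L n} {t : Transition L n} (ht : t ∈ V.trns) :
    (∃ r z, V.SolvesB t r z) ∨ ∃ μ, V.SolvesA t μ := by
  classical
  set α : Transition L n ⊕ Fin n → (Fin n → ℚ) × (L → ℚ) →ₗ[ℚ] ℚ :=
    Sum.elim lineForm (fun i => -(LinearMap.proj i ∘ₗ LinearMap.fst ℚ _ _)) with hα
  by_cases hf : ∀ x, (∀ j ∈ V.trns.disjSum Finset.univ, α j x ≤ 0) → (-lineForm t) x ≤ 0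
  · right
    obtain ⟨u, hu, he⟩ := exists_nonneg_combination_of_forall_nonpos _ α (-lineForm t) hf
    -- Moving the target to the other side adds one to the multiplier of `t`, which makes it
    -- positive.
    set w : Transition L n → ℚ := fun t' => u (.inl t') + if t' = t then 1 else 0 with hw
    have hsum : ∀ f : Transition L n → ℚ, ∑ t' ∈ V.trns, f t' * w t' =
        ∑ t' ∈ V.trns, f t' * u (.inl t') + f t := by
      intro f
      simp [hw, mul_add, Finset.sum_add_distrib, ht]
    have hev : ∀ r z, ∑ t' ∈ V.trns, lineForm t' (r, z) * w t' = ∑ i, u (.inr i) * r i := by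
      intro r z
      have := LinearMap.congr_fun he (r, z)
      simp only [Finset.sum_disjSum, hα, Sum.elim_inl, Sum.elim_inr, LinearMap.add_apply,
        LinearMap.sum_apply, LinearMap.smul_apply, LinearMap.neg_apply, smul_eq_mul,
        LinearMap.comp_apply, LinearMap.fst_apply, LinearMap.proj_apply, mul_neg,
        Finset.sum_neg_distrib] at this
      rw [hsum]
      simp only [mul_comm (u _)] at this ⊢
      linarith
    refine exists_solvesA_of_rat ht (u := w) (fun t' => ?_) ?_ (fun i => ?_) (fun l => ?_)
    · have := hu (.inl t')
      simp only [hw]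
      split_ifs <;> linarith
    · have := hu (.inl t)
      simp only [hw, if_true]
      linarith
    -- Unit vectors in `r` read off the total updates; unit vectors in `z` read off the flow
    -- balance.
    · have := hev (Pi.single i 1) 0
      simp only [lineForm_apply, Pi.single_apply, Pi.zero_apply, mul_ite, mul_one, mul_zero,
        Finset.sum_ite_eq', Finset.mem_univ, if_true, sub_zero, add_zero] at this
      rw [this]
      exact hu _
    · have := hev 0 (Pi.single l 1)
      simp only [lineForm_apply, Pi.single_apply, Pi.zero_apply, mul_zero,
        Finset.sum_const_zero, zero_add, sub_mul, ite_mul, one_mul, zero_mul,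
        Finset.sum_sub_distrib] at this
      rw [Finset.sum_filter, Finset.sum_filter]
      linarith
  · left
    push Not at hf
    obtain ⟨⟨r, z⟩, hx, hγ⟩ := hf
    refine exists_solvesB_of_rat ht (r := r) (z := z) (fun i => ?_) (fun t' ht' => ?_) ?_
    · have := hx (.inr i) (by simp)
      simpa [hα] using this
    · exact hx (.inl t') (by simpa using ht')
    · simpa using hγ

/-- Every transition outside `T` has a solution of its system `(A_t)` supported outside `T`. -/
theorem exists_solvesA_support {V : VASS L n} {T : Finset (Transition L n)}
    (hT : ∀ t, t ∈ T ↔ t ∈ V.trns ∧ ∃ r z, V.SolvesB t r z) {t : Transition L n}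
    (ht : t ∈ (V.removeTrns T).trns) :
    ∃ μ, V.SolvesA t μ ∧ ∀ t', μ t' ≠ 0 → t' ∈ (V.removeTrns T).trns := by
  obtain ⟨h1, h2⟩ := Finset.mem_sdiff.mp ht
  rcases exists_solvesB_or_exists_solvesA h1 with h | ⟨μ, hμ⟩
  · exact absurd ((hT t).mpr ⟨h1, h⟩) h2
  · refine ⟨μ, hμ, fun t' ht' => Finset.mem_sdiff.mpr ⟨?_, fun hc => ?_⟩⟩
    · by_contra hc
      exact ht' (hμ.1 t' hc)
    · obtain ⟨r, z, h⟩ := ((hT t').mp hc).2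
      exact hμ.not_solvesB ht' r z h

/-- A solution of `(A_t)` supported outside `T` provides a way back from the target that avoids `T`.
So no transition runs between different components once `T` is removed. -/
theorem mutualReach_of_mem_removeTrns {V : VASS L n} {T : Finset (Transition L n)}
    (hT : ∀ t, t ∈ T ↔ t ∈ V.trns ∧ ∃ r z, V.SolvesB t r z) {t : Transition L n}
    (ht : t ∈ (V.removeTrns T).trns) : (V.removeTrns T).mutualReach t.src t.tgt := by
  obtain ⟨μ, hμ, hs⟩ := exists_solvesA_support hT ht
  exact ⟨Reach.of_mem ht, hμ.circulation.reach_tgt_src (fun t' _ h => hs t' h)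
    (Nat.one_le_iff_ne_zero.mp hμ.2.2.2)⟩

/-- The procedure `ranking` always returns a result. -/
theorem exists_ranking (V : VASS L n) :
    (∃ rank, V.Ranking (.terminating rank)) ∨ ∃ w, V.Ranking (.nonterminating w) := by
  classical
  induction hk : V.trns.card using Nat.strong_induction_on generalizing V with
  | _ k ih =>
  rcases V.trns.eq_empty_or_nonempty with h0 | h0
  · exact .inl ⟨_, .noTransitions V h0⟩
  set T := V.trns.filter fun t => ∃ r z, V.SolvesB t r z with hTdef
  have hT : ∀ t, t ∈ T ↔ t ∈ V.trns ∧ ∃ r z, V.SolvesB t r z := fun t => Finset.mem_filter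
  rcases T.eq_empty_or_nonempty with hT0 | hT0
  · right
    have hB : ∀ t ∈ V.trns, ¬ ∃ r z, V.SolvesB t r z := fun t ht hc =>
      Finset.notMem_empty t (hT0 ▸ (hT t).mpr ⟨ht, hc⟩)
    have hA : ∀ t, ∃ μ, t ∈ V.trns → V.SolvesA t μ := fun t => by
      by_cases ht : t ∈ V.trns
      · obtain ⟨μ, hμ⟩ := (exists_solvesB_or_exists_solvesA ht).resolve_left (hB t ht)
        exact ⟨μ, fun _ => hμ⟩
      · exact ⟨0, fun h => absurd h ht⟩
    choose μ hμ using hA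
    exact ⟨_, .noDecrease V h0 hB μ hμ⟩
  · have hsol : ∀ t, ∃ r z, t ∈ T → V.SolvesB t r z := fun t => by
      by_cases ht : t ∈ T
      · obtain ⟨r, z, h⟩ := ((hT t).mp ht).2
        exact ⟨r, z, fun _ => h⟩
      · exact ⟨0, 0, fun h => absurd h ht⟩
    choose r z hrz using hsol
    have hstage : V.QuasiRankStage T (fun σ => ∑ t ∈ T, affineRank (r t) (z t) σ) :=
      ⟨hT, hT0, r, z, hrz, fun _ => rfl⟩
    have hsub : ∀ S : VASS L n, S.IsSCC (V.removeTrns T) → S.trns.card < k := by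
      intro S hS
      rw [← hk]
      refine Finset.card_lt_card (Finset.ssubset_of_subset_of_ssubset hS.1.2 ?_)
      obtain ⟨t, ht⟩ := hT0
      refine Finset.sdiff_subset.ssubset_of_ne fun he => ?_
      have := he ▸ ((hT t).mp ht).1
      exact (Finset.mem_sdiff.mp this).2 ht
    by_cases hex : ∃ S : VASS L n, S.IsSCC (V.removeTrns T) ∧ ∃ w, S.Ranking (.nonterminating w)
    · obtain ⟨S, hS, w, hw⟩ := hex
      exact .inr ⟨w, .recNonterminating V T _ hstage S hS w hw⟩
    · have hrk : ∀ S : VASS L n, ∃ rank, S.IsSCC (V.removeTrns T) →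
          S.Ranking (.terminating rank) := by
        intro S
        by_cases hS : S.IsSCC (V.removeTrns T)
        · rcases ih _ (hsub S hS) S rfl with ⟨rank, h⟩ | h
          · exact ⟨rank, fun _ => h⟩
          · exact absurd ⟨S, hS, h⟩ hex
        · exact ⟨fun _ => [], fun h => absurd h hS⟩
      choose rankS hrankS using hrk
      refine .inl ⟨fun σ => (∑ t ∈ T, affineRank (r t) (z t) σ) ::
          rankS ((V.removeTrns T).sccOf σ.1) σ,
        .recTerminating V T _ hstage rankS hrankS _ fun S hS l hl ν => ?_⟩
      simp only [hS.eq_sccOf hl]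

end VASS

theorem List.exists_max_length {α : Type*} {P : List α → Prop} {B : ℕ}
    (hB : ∀ w, P w → w.length ≤ B) (h : ∃ w, P w) :
    ∃ w, P w ∧ ∀ w', P w' → w'.length ≤ w.length := by
  classical
  have hex : ∃ k w, P w ∧ B - w.length = k := by
    obtain ⟨w, hw⟩ := h
    exact ⟨_, w, hw, rfl⟩
  obtain ⟨w, hw, he⟩ := Nat.find_spec hex
  refine ⟨w, hw, fun w' hw' => ?_⟩
  have h1 := Nat.find_min' hex ⟨w', hw', rfl⟩
  have h2 := hB w hw
  have h3 := hB w' hw'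
  omega

theorem List.prefix_append_cases {α : Type*} {p u v : List α} (h : p <+: u ++ v) :
    p <+: u ∨ ∃ q, p = u ++ q ∧ q <+: v := by
  obtain ⟨s, hs⟩ := h
  rcases List.append_eq_append_iff.mp hs with ⟨r, rfl, -⟩ | ⟨r, rfl, rfl⟩
  · exact .inl (List.prefix_append p r)
  · exact .inr ⟨r, rfl, List.prefix_append r s⟩

namespace VASS

variable {L : Type*} {n : ℕ}

/-! ### Walks -/

/-- The list `w` of transitions is a walk from `a` to `b`. -/
def IsWalk (V : VASS L n) : L → List (Transition L n) → L → Prop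
  | a, [], b => a = b
  | a, t :: w, b => t ∈ V.trns ∧ t.src = a ∧ V.IsWalk t.tgt w b

/-- The sum of the updates of a list of transitions. -/
def effect (w : List (Transition L n)) (i : Fin n) : ℤ := (w.map fun t => t.update i).sum

/-- No coordinate drops by more than `B` along `w`. -/
def DropLE (w : List (Transition L n)) (B : ℕ) : Prop := ∀ u, u <+: w → ∀ i, -(B : ℤ) ≤ effect u i

@[simp] theorem effect_nil (i : Fin n) : effect ([] : List (Transition L n)) i = 0 := rfl

@[simp] theorem effect_cons (t : Transition L n) (w : List (Transition L n)) (i : Fin n) :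
    effect (t :: w) i = t.update i + effect w i := by simp [effect]

@[simp] theorem effect_append (u w : List (Transition L n)) (i : Fin n) :
    effect (u ++ w) i = effect u i + effect w i := by simp [effect]

theorem isWalk_append {V : VASS L n} {a c : L} {u v : List (Transition L n)} :
    V.IsWalk a (u ++ v) c ↔ ∃ b, V.IsWalk a u b ∧ V.IsWalk b v c := by
  induction u generalizing a with
  | nil => simp [IsWalk]
  | cons t u ih =>
    simp only [List.cons_append, IsWalk, ih]
    tauto

theorem IsWalk.append {V : VASS L n} {a b c : L} {u v : List (Transition L n)}
    (h : V.IsWalk a u b) (h' : V.IsWalk b v c) : V.IsWalk a (u ++ v) c :=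
  isWalk_append.mpr ⟨b, h, h'⟩

theorem isWalk_singleton {V : VASS L n} {t : Transition L n} (ht : t ∈ V.trns) :
    V.IsWalk t.src [t] t.tgt := ⟨ht, rfl, rfl⟩

theorem IsWalk.mem_trns {V : VASS L n} {a b : L} {w : List (Transition L n)}
    (h : V.IsWalk a w b) : ∀ t ∈ w, t ∈ V.trns := by
  induction w generalizing a with
  | nil => simp
  | cons s w ih =>
    intro t ht
    rcases List.mem_cons.mp ht with rfl | ht
    · exact h.1
    · exact ih h.2.2 t ht

theorem IsWalk.unique {V : VASS L n} {a b b' : L} {w : List (Transition L n)}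
    (h : V.IsWalk a w b) (h' : V.IsWalk a w b') : b = b' := by
  induction w generalizing a with
  | nil => exact h.symm.trans h'
  | cons s w ih => exact ih h.2.2 h'.2.2

theorem IsWalk.mono {S V : VASS L n} (hSV : S.trns ⊆ V.trns) {a b : L}
    {w : List (Transition L n)} (h : S.IsWalk a w b) : V.IsWalk a w b := by
  induction w generalizing a with
  | nil => exact h
  | cons s w ih => exact ⟨hSV h.1, h.2.1, ih h.2.2⟩

theorem Reach.exists_isWalk {V : VASS L n} {a b : L} (h : V.Reach a b) : ∃ w, V.IsWalk a w b := by
  induction h with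
  | refl => exact ⟨[], rfl⟩
  | tail _ h ih =>
    obtain ⟨w, hw⟩ := ih
    obtain ⟨d, hd⟩ := h
    exact ⟨w ++ [(_, d, _)], hw.append ⟨hd, rfl, rfl⟩⟩

/-- The walk `w` from `a` visits `x`. -/
def Visits (V : VASS L n) (a : L) (w : List (Transition L n)) (x : L) : Prop :=
  ∃ u v, w = u ++ v ∧ V.IsWalk a u x

theorem IsWalk.visits {V : VASS L n} {a b : L} {w : List (Transition L n)}
    (h : V.IsWalk a w b) {t : Transition L n} (ht : t ∈ w) :
    V.Visits a w t.tgt := by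
  obtain ⟨u, v, rfl⟩ := List.append_of_mem ht
  obtain ⟨c, h1, h2⟩ := isWalk_append.mp h
  obtain ⟨h3, rfl, h4⟩ := h2
  exact ⟨u ++ [t], v, by simp, h1.append (isWalk_singleton h3)⟩

/-- Insertion of a closed walk at a visited location. -/
theorem IsWalk.insert {V : VASS L n} {a b x : L} {w c : List (Transition L n)}
    (h : V.IsWalk a w b) (hx : V.Visits a w x) (hc : V.IsWalk x c x) :
    ∃ w', V.IsWalk a w' b ∧ w'.Perm (c ++ w) ∧ (∀ y, V.Visits a w y → V.Visits a w' y) ∧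
      ∀ A B, DropLE w A → DropLE c B → DropLE w' (A + B) := by
  obtain ⟨u, v, rfl, hu⟩ := hx
  obtain ⟨x', hu', hv⟩ := isWalk_append.mp h
  obtain rfl := hu.unique hu'
  refine ⟨u ++ (c ++ v), hu.append (hc.append hv), ?_, ?_, ?_⟩
  · rw [← List.append_assoc, ← List.append_assoc]
    exact List.perm_append_comm.append_right v
  · rintro y ⟨p, q, he, hp⟩
    rcases List.append_eq_append_iff.mp he with ⟨r, rfl, rfl⟩ | ⟨r, rfl, rfl⟩
    · obtain ⟨x', hu', hr⟩ := isWalk_append.mp hp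
      obtain rfl := hu.unique hu'
      exact ⟨u ++ (c ++ r), q, by simp, hu.append (hc.append hr)⟩
    · exact ⟨p, r ++ (c ++ v), by simp, hp⟩
  · intro A B hA hB p hp i
    rcases List.prefix_append_cases hp with hp | ⟨q, rfl, hq⟩
    · have := hA p (hp.trans (List.prefix_append u v)) i
      push_cast
      omega
    · rcases List.prefix_append_cases hq with hq | ⟨r, rfl, hr⟩
      · have h1 := hA u (List.prefix_append u v) i
        have h2 := hB q hq i
        rw [effect_append]
        push_cast
        omega
      -- A prefix that ends after the detour consists of a prefix of `w` and all of `c`, up to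
      -- order, so the two drops add.
      · have h1 := hA (u ++ r) ((List.prefix_append_right_inj u).mpr hr) i
        have h2 := hB c List.prefix_rfl i
        simp only [effect_append] at h1 ⊢
        push_cast
        omega

theorem effect_eq_of_perm {u w : List (Transition L n)} (h : u.Perm w) (i : Fin n) :
    effect u i = effect w i := (h.map _).sum_eq

theorem exists_dropLE (w : List (Transition L n)) : ∃ B, DropLE w B := by
  induction w with
  | nil => exact ⟨0, fun u hu i => by simp [List.prefix_nil.mp hu]⟩
  | cons t w ih =>
    obtain ⟨B, hB⟩ := ih
    refine ⟨B + ∑ i, (t.update i).natAbs, fun u hu i => ?_⟩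
    rcases List.prefix_cons_iff.mp hu with rfl | ⟨v, rfl, hv⟩
    · simp only [effect_nil]
      omega
    · have h1 := hB v hv i
      have h2 : (t.update i).natAbs ≤ ∑ i, (t.update i).natAbs :=
        Finset.single_le_sum (f := fun i => (t.update i).natAbs) (fun _ _ => Nat.zero_le _)
          (Finset.mem_univ i)
      rw [effect_cons]
      push_cast
      have := neg_abs_le (t.update i)
      linarith

/-- Completed rounds cost only their net loss `A`; the inner drop `B` is paid once, in the
unfinished round. This keeps the drop linear in the lower bound, where `B` itself grows with `N`. -/
theorem IsWalk.iterate {V : VASS L n} {b : L} {w : List (Transition L n)} (h : V.IsWalk b w b)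
    {A B : ℕ} (hA : ∀ i, -(A : ℤ) ≤ effect w i) (hB : DropLE w B) (N : ℕ) :
    ∃ w', V.IsWalk b w' b ∧ (∀ i, effect w' i = N * effect w i) ∧ DropLE w' (N * A + B) ∧
      w'.length = N * w.length := by
  induction N with
  | zero => exact ⟨[], rfl, by simp, fun u hu i => by simp [List.prefix_nil.mp hu], by simp⟩
  | succ N ih =>
    obtain ⟨w', h1, h2, h3, h4⟩ := ih
    refine ⟨w ++ w', h.append h1, fun i => ?_, fun u hu i => ?_, ?_⟩
    · rw [effect_append, h2]
      push_cast
      ring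
    · rcases List.prefix_append_cases hu with hu | ⟨q, rfl, hq⟩
      · have := hB u hu i
        have : 0 ≤ (((N + 1) * A : ℕ) : ℤ) := by positivity
        push_cast at this ⊢
        linarith
      · have h5 := h3 q hq i
        have h6 := hA i
        rw [effect_append]
        push_cast at h5 ⊢
        linarith
    · rw [List.length_append, h4]
      ring

/-! ### Walks and traces -/

theorem HasTrace.cons {V : VASS L n} {σ σ' : VState L n} {d : Fin n → ℤ} (h : V.Step σ d σ')
    {m : ℕ} (h' : V.HasTrace σ' m) : V.HasTrace σ (m + 1) := by
  obtain ⟨τ, h0, hτ⟩ := h'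
  refine ⟨fun k => Nat.casesOn k σ τ, rfl, fun i hi => ?_⟩
  cases i with
  | zero => exact ⟨d, by simpa [h0] using h⟩
  | succ i => exact hτ i (by omega)

theorem IsWalk.hasTrace {V : VASS L n} {a b : L} {w : List (Transition L n)}
    (h : V.IsWalk a w b) {ν : Fin n → ℕ} (hν : ∀ u, u <+: w → ∀ i, 0 ≤ (ν i : ℤ) + effect u i) :
    V.HasTrace (a, ν) w.length := by
  induction w generalizing a ν with
  | nil => exact ⟨fun _ => (a, ν), rfl, fun i hi => absurd hi (Nat.not_lt_zero i)⟩
  | cons t w ih =>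
    obtain ⟨h1, rfl, h2⟩ := h
    have h0 : ∀ i, 0 ≤ (ν i : ℤ) + t.update i := fun i => by
      simpa using hν [t] (by simp) i
    refine HasTrace.cons (d := t.update) (σ' := (t.tgt, fun i => ((ν i : ℤ) + t.update i).toNat))
      ⟨h1, fun i => Int.toNat_of_nonneg (h0 i)⟩ (ih h2 fun u hu i => ?_)
    have := hν (t :: u) (List.cons_prefix_cons.mpr ⟨rfl, hu⟩) i
    rw [effect_cons] at this
    rw [Int.toNat_of_nonneg (h0 i)]
    linarith

theorem not_terminating_of_forall_exists_step {V : VASS L n} {X : Set (VState L n)}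
    (hne : X.Nonempty) (hX : ∀ σ ∈ X, ∃ d, ∃ σ' ∈ X, V.Step σ d σ') : ¬ V.Terminating := by
  obtain ⟨σ₀, h₀⟩ := hne
  choose d f hf hstep using hX
  refine not_not.mpr ⟨fun i => ((fun σ : X => (⟨f σ.1 σ.2, hf σ.1 σ.2⟩ : X))^[i] ⟨σ₀, h₀⟩).1,
    fun i => ?_⟩
  simp only [Function.iterate_succ_apply']
  exact ⟨_, hstep _ _⟩

/-- Starting with `A` in every coordinate, the walk can be repeated forever. The invariant is that
after the prefix `p` of a round the counters are at least `A` plus the effect of `p`; it survives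
the start of a new round because the effect of `w` is nonnegative. -/
theorem IsWalk.not_terminating {V : VASS L n} {b : L} {w : List (Transition L n)}
    (h : V.IsWalk b w b) (hne : w ≠ []) (hw : ∀ i, 0 ≤ effect w i) : ¬ V.Terminating := by
  obtain ⟨A, hA⟩ := exists_dropLE w
  refine not_terminating_of_forall_exists_step (X := {σ | ∃ p s, p ++ s = w ∧ s ≠ [] ∧
    V.IsWalk σ.1 s b ∧ ∀ i, (A : ℤ) + effect p i ≤ σ.2 i}) ⟨(b, fun _ => A), [], w, rfl, hne, h,
      fun i => by simp⟩ ?_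
  rintro ⟨l, ν⟩ ⟨p, s, rfl, hs, hwalk, hν⟩
  obtain ⟨t, s, rfl⟩ := List.exists_cons_of_ne_nil hs
  obtain ⟨h1, rfl, h2⟩ := hwalk
  have hle : ∀ i, (A : ℤ) + effect (p ++ [t]) i ≤ ν i + t.update i := fun i => by
    have := hν i
    simp only [effect_append, effect_cons, effect_nil] at this ⊢
    linarith
  have h0 : ∀ i, 0 ≤ (ν i : ℤ) + t.update i := fun i => by
    have := hA (p ++ [t]) ⟨s, by simp⟩ i
    have := hle i
    linarith
  refine ⟨t.update, (t.tgt, fun i => ((ν i : ℤ) + t.update i).toNat), ?_,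
    h1, fun i => Int.toNat_of_nonneg (h0 i)⟩
  rcases s.eq_nil_or_concat with rfl | hs'
  · obtain rfl : t.tgt = b := h2
    refine ⟨[], p ++ [t], rfl, by simp, h, fun i => ?_⟩
    have := hw i
    have := hle i
    rw [Int.toNat_of_nonneg (h0 i), effect_nil]
    linarith
  · refine ⟨p ++ [t], s, by simp, ?_, h2, fun i => ?_⟩
    · rintro rfl
      simp at hs'
    · rw [Int.toNat_of_nonneg (h0 i)]
      exact hle i

/-- A walk that contains all transitions of a connected system visits all locations. -/
theorem IsWalk.visits_all {V : VASS L n} (hV : V.Connected) {a b : L} (ha : a ∈ V.locs)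
    {w : List (Transition L n)} (h : V.IsWalk a w b)
    (hw : ∀ t ∈ V.trns, V.Visits a w t.src → t ∈ w) {x : L} (hx : x ∈ V.locs) :
    V.Visits a w x :=
  (hV a ha x hx).closed (X := {x | V.Visits a w x}) (fun t ht hs => h.visits (hw t ht hs))
    ⟨[], w, rfl, rfl⟩

theorem Terminating.of_isSub {S V : VASS L n} (hSV : S.IsSub V) (hV : V.Terminating) :
    S.Terminating := fun ⟨σ, hσ⟩ =>
  hV ⟨σ, fun i => (hσ i).imp fun _ h => ⟨hSV.2 h.1, h.2⟩⟩

/-! ### Eulerian walks -/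

variable [DecidableEq L]

theorem IsWalk.count_balance {V : VASS L n} {a b : L} {w : List (Transition L n)}
    (h : V.IsWalk a w b) (l : L) :
    ∑ t ∈ V.trns with t.tgt = l, w.count t + (if a = l then 1 else 0) =
      ∑ t ∈ V.trns with t.src = l, w.count t + (if b = l then 1 else 0) := by
  induction w generalizing a with
  | nil =>
    obtain rfl : a = b := h
    simp
  | cons s w ih =>
    obtain ⟨h1, rfl, h2⟩ := h
    have := ih h2
    simp only [List.count_cons, Finset.sum_add_distrib, beq_iff_eq, Finset.sum_ite_eq,
      Finset.mem_filter, h1, true_and]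
    omega

theorem IsWalk.circulation {V : VASS L n} {b : L} {w : List (Transition L n)}
    (h : V.IsWalk b w b) : V.Circulation (fun t => w.count t) :=
  ⟨fun _ ht => List.count_eq_zero.mpr fun hc => ht (h.mem_trns _ hc), fun l =>
    Nat.add_right_cancel (h.count_balance l)⟩

theorem IsWalk.totalUpdate_count {V : VASS L n} {a b : L} {w : List (Transition L n)}
    (h : V.IsWalk a w b) (i : Fin n) : V.totalUpdate (fun t => w.count t) i = effect w i := by
  induction w generalizing a with
  | nil => simp [totalUpdate]
  | cons s w ih =>
    have := ih h.2.2
    simp only [totalUpdate, List.count_cons, beq_iff_eq] at this ⊢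
    simp only [Nat.cast_add, mul_add, Finset.sum_add_distrib, this, Nat.cast_ite, Nat.cast_one,
      Nat.cast_zero, mul_ite, mul_one, mul_zero, Finset.sum_ite_eq, h.1, if_true, effect_cons]
    ring

theorem IsWalk.length_eq_sum_count {V : VASS L n} {a b : L} {w : List (Transition L n)}
    (h : V.IsWalk a w b) : w.length = ∑ t ∈ V.trns, w.count t := by
  induction w generalizing a with
  | nil => simp
  | cons s w ih =>
    simp only [List.length_cons, List.count_cons, beq_iff_eq, Finset.sum_add_distrib,
      Finset.sum_ite_eq, h.1, if_true, ih h.2.2]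

theorem IsWalk.length_le {V : VASS L n} {a b : L} {w : List (Transition L n)}
    (h : V.IsWalk a w b) {m : Transition L n → ℕ} (hm : ∀ t, w.count t ≤ m t) :
    w.length ≤ ∑ t ∈ V.trns, m t :=
  h.length_eq_sum_count.trans_le (Finset.sum_le_sum fun t _ => hm t)

/-- A transition of positive weight in a circulation starts a closed walk within it. -/
theorem Circulation.exists_isWalk {V : VASS L n} {m : Transition L n → ℕ} (h : V.Circulation m)
    {t : Transition L n} (ht : m t ≠ 0) :
    ∃ w, w ≠ [] ∧ V.IsWalk t.src w t.src ∧ ∀ s, w.count s ≤ m s := by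
  have htV : t ∈ V.trns := by by_contra hc; exact ht (h.1 t hc)
  have h0 : V.IsWalk t.src [t] t.tgt ∧ ∀ s, [t].count s ≤ m s := by
    refine ⟨isWalk_singleton htV, fun s => ?_⟩
    rw [List.count_singleton]
    split_ifs with hs
    · rw [beq_iff_eq] at hs
      subst hs
      omega
    · exact Nat.zero_le _
  obtain ⟨w, ⟨y, hw, hc⟩, hmax⟩ := List.exists_max_length
    (P := fun w => ∃ y, V.IsWalk t.src w y ∧ ∀ s, w.count s ≤ m s)
    (fun w ⟨y, hw, hc⟩ => hw.length_le hc) ⟨[t], _, h0⟩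
  have hne : w ≠ [] := by
    rintro rfl
    simpa using hmax [t] ⟨_, h0⟩
  by_cases hy : t.src = y
  · subst hy
    exact ⟨w, hne, hw, hc⟩
  -- A longest walk within `m` that ends at `y`, away from its start, has entered `y` once more than
  -- it has left it. So some outgoing transition has weight to spare and extends the walk.
  have hb := hw.count_balance y
  rw [if_neg hy, if_pos rfl] at hb
  have h1 : ∑ s ∈ V.trns with s.tgt = y, w.count s ≤ ∑ s ∈ V.trns with s.tgt = y, m s :=
    Finset.sum_le_sum fun s _ => hc s
  have h2 : ∑ s ∈ V.trns with s.src = y, w.count s < ∑ s ∈ V.trns with s.src = y, m s := by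
    have := h.2 y
    omega
  obtain ⟨s, hs, hlt⟩ := Finset.exists_lt_of_sum_lt h2
  obtain ⟨hsV, rfl⟩ := Finset.mem_filter.mp hs
  have := hmax (w ++ [s]) ⟨s.tgt, hw.append (isWalk_singleton hsV), fun s' => by
    rw [List.count_append, List.count_singleton]
    split_ifs with he
    · rw [beq_iff_eq] at he
      subst he
      omega
    · exact hc s'⟩
  simp at this

/-- A circulation of full support on a connected system is an Eulerian closed walk. -/
theorem Circulation.exists_eulerian {V : VASS L n} (hV : V.Connected) {m : Transition L n → ℕ}
    (hm : V.Circulation m) (hfull : ∀ t ∈ V.trns, 1 ≤ m t) {b : L} (hb : b ∈ V.locs) :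
    ∃ w, V.IsWalk b w b ∧ ∀ t, w.count t = m t := by
  obtain ⟨w, ⟨hw, hc⟩, hmax⟩ := List.exists_max_length
    (P := fun w => V.IsWalk b w b ∧ ∀ s, w.count s ≤ m s)
    (fun w ⟨hw, hc⟩ => hw.length_le hc) ⟨[], rfl, by simp⟩
  have hres : V.Circulation (fun t => m t - w.count t) := by
    refine ⟨fun t ht => by simp [hm.1 t ht], fun l => ?_⟩
    have key : ∀ p : Transition L n → Prop, ∀ [DecidablePred p],
        ∑ t ∈ V.trns with p t, (m t - w.count t) + ∑ t ∈ V.trns with p t, w.count t =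
          ∑ t ∈ V.trns with p t, m t := by
      intro p _
      rw [← Finset.sum_add_distrib]
      exact Finset.sum_congr rfl fun t _ => Nat.sub_add_cancel (hc t)
    have h1 := key (fun t => t.tgt = l)
    have h2 := key (fun t => t.src = l)
    have h3 := hm.2 l
    have h4 := hw.circulation.2 l
    beta_reduce at h1 h2 h4 ⊢
    omega
  -- Hierholzer's argument: spare weight at a visited location starts a closed walk in the residual
  -- circulation, and inserting it would lengthen the maximal walk.
  have hdone : ∀ t ∈ V.trns, V.Visits b w t.src → w.count t = m t := by
    intro t ht hv
    by_contra hne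
    have hlt := lt_of_le_of_ne (hc t) hne
    obtain ⟨c, hcne, hcw, hcc⟩ := hres.exists_isWalk (t := t) (by omega)
    obtain ⟨w', hw', hp, -, -⟩ := hw.insert hv hcw
    have := hmax w' ⟨hw', fun s => by
      rw [hp.count_eq, List.count_append]
      have := hcc s
      have := hc s
      beta_reduce at *
      omega⟩
    rw [hp.length_eq, List.length_append] at this
    have := List.length_pos_of_ne_nil hcne
    omega
  refine ⟨w, hw, fun t => ?_⟩
  by_cases ht : t ∈ V.trns
  · refine hdone t ht (hw.visits_all hV hb (fun s hs hv => ?_) (V.src_mem t ht))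
    rw [← List.count_pos_iff, hdone s hs hv]
    exact hfull s hs
  · rw [hm.1 t ht]
    exact Nat.le_zero.mp ((hc t).trans_eq (hm.1 t ht))

/-- A witness for non-termination is returned only for systems that do not terminate. -/
theorem Ranking.not_terminating {V : VASS L n} {res : RankingResult L n} (h : V.Ranking res)
    {w : Transition L n → ℕ} (hw : res = .nonterminating w) (hV : V.Connected) :
    ¬ V.Terminating := by
  induction h with
  | noTransitions | recTerminating => simp at hw
  | noDecrease V hne hB μ hμ =>
    have hcirc := Circulation.sum V.trns fun t ht => (hμ t ht).circulation
    have hfull : ∀ t ∈ V.trns, 1 ≤ ∑ s ∈ V.trns, μ s t := fun t ht =>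
      (hμ t ht).2.2.2.trans (Finset.single_le_sum (f := fun s => μ s t)
        (fun _ _ => Nat.zero_le _) ht)
    obtain ⟨t, ht⟩ := hne
    obtain ⟨e, he, hce⟩ := hcirc.exists_eulerian hV hfull (V.src_mem t ht)
    refine he.not_terminating ?_ fun i => ?_
    · rintro rfl
      have := hfull t ht
      rw [← hce t] at this
      simp at this
    · rw [← he.totalUpdate_count, funext hce, totalUpdate_sum]
      exact Finset.sum_nonneg fun s hs => (hμ s hs).2.1 i
  | recNonterminating V T q hT S hS w' hw' ih =>
    exact fun hterm => ih hw hS.2.1 (Terminating.of_isSub (S := S) (V := V)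
      ⟨hS.1.1, hS.1.2.trans Finset.sdiff_subset⟩ hterm)

end VASS

namespace VASS

variable {L : Type*} {n : ℕ}

/-! ### Lexicographic descent -/

theorem lexGT_cons {a b : ℕ} {x y : List ℕ} :
    LexGT (a :: x) (b :: y) ↔ b < a ∨ a = b ∧ LexGT x y := by
  constructor
  · rintro ⟨i, hx, hy, hlt, he⟩
    cases i with
    | zero => exact .inl hlt
    | succ i =>
      simp only [List.take_succ_cons, List.cons.injEq] at he
      exact .inr ⟨he.1, i, by simpa using hx, by simpa using hy, hlt, he.2⟩
  · rintro (h | ⟨rfl, i, hx, hy, hlt, he⟩)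
    · exact ⟨0, by simp, by simp, h, rfl⟩
    · exact ⟨i + 1, by simpa using hx, by simpa using hy, hlt, by simpa using he⟩

theorem not_lexGT_nil_left (y : List ℕ) : ¬ LexGT [] y := fun ⟨i, hx, _⟩ =>
  absurd hx (Nat.not_lt_zero i)

theorem not_lexGT_nil_right (x : List ℕ) : ¬ LexGT x [] := fun ⟨i, _, hy, _⟩ =>
  absurd hy (Nat.not_lt_zero i)

/-- The first `k` entries of a sequence, read as digits in base `B`. -/
def lexCode (B : ℕ) : ℕ → List ℕ → ℕ
  | 0, _ => 0
  | _ + 1, [] => 0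
  | k + 1, x :: xs => x * B ^ k + lexCode B k xs

theorem lexCode_lt {B : ℕ} (hB : 0 < B) (k : ℕ) {x : List ℕ} (hx : ∀ a ∈ x, a < B) :
    lexCode B k x < B ^ k := by
  induction k generalizing x with
  | zero => simp [lexCode]
  | succ k ih =>
    cases x with
    | nil => exact Nat.pow_pos hB
    | cons a x =>
      have h1 := ih (x := x) fun b hb => hx b (List.mem_cons_of_mem a hb)
      have h2 : (a + 1) * B ^ k ≤ B * B ^ k := Nat.mul_le_mul_right _ (hx a (by simp))
      rw [lexCode, pow_succ']
      linarith

/-- The deciding position exists in `x`, hence lies among the first `k` digits; `y` may be longer.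
Only the digits of `y` need a bound, since its tail must not outweigh the gain there. -/
theorem lexCode_lt_of_lexGT {B k : ℕ} {x y : List ℕ} (hy : ∀ a ∈ y, a < B)
    (hk : x.length ≤ k) (h : LexGT x y) : lexCode B k y < lexCode B k x := by
  induction k generalizing x y with
  | zero =>
    obtain rfl := List.length_eq_zero_iff.mp (Nat.le_zero.mp hk)
    exact absurd h (not_lexGT_nil_left y)
  | succ k ih =>
    cases x with
    | nil => exact absurd h (not_lexGT_nil_left y)
    | cons a x =>
      cases y with
      | nil => exact absurd h (not_lexGT_nil_right _)
      | cons b y =>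
        have hy' : ∀ a ∈ y, a < B := fun c hc => hy c (List.mem_cons_of_mem b hc)
        rw [lexCode, lexCode]
        rcases lexGT_cons.mp h with hba | ⟨rfl, hxy⟩
        · have h1 := lexCode_lt (Nat.zero_lt_of_lt (hy b (by simp))) k hy'
          have h2 : (b + 1) * B ^ k ≤ a * B ^ k := Nat.mul_le_mul_right _ hba
          linarith
        · exact Nat.add_lt_add_left (ih hy' (Nat.le_of_succ_le_succ hk) hxy) _

theorem Conservative.sum_step {V : VASS L n} (hV : V.Conservative) {σ σ' : VState L n}
    {d : Fin n → ℤ} (h : V.Step σ d σ') : ∑ i, σ'.2 i = ∑ i, σ.2 i := by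
  have h1 : ∑ i, (σ'.2 i : ℤ) = ∑ i, (σ.2 i : ℤ) := by
    rw [Finset.sum_congr rfl fun i _ => h.2 i, Finset.sum_add_distrib]
    simpa [Transition.update] using hV _ h.1
  exact_mod_cast h1

theorem Conservative.lt_of_hasTrace {V : VASS L n} (hV : V.Conservative)
    {rank : VState L n → List ℕ} (hlex : V.IsLexRanking rank) {A k : ℕ}
    (hA : ∀ l ∈ V.locs, ∀ ν, ∀ x ∈ rank (l, ν), x ≤ A * (∑ i, ν i + 1))
    (hk : ∀ l ∈ V.locs, ∀ ν, (rank (l, ν)).length ≤ k) {N m : ℕ} {σ₀ : VState L n}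
    (hσ : V.IsBoundedState N σ₀) (h : V.HasTrace σ₀ m) : m < (A * (n * N + 1) + 1) ^ k := by
  obtain ⟨σ, rfl, hstep⟩ := h
  set B := A * (n * N + 1) + 1
  have hsum : ∑ i, (σ 0).2 i ≤ n * N := by
    simpa using Finset.sum_le_card_nsmul Finset.univ (σ 0).2 N fun i _ => hσ.2 i
  have hinv : ∀ i ≤ m, (σ i).1 ∈ V.locs ∧ ∑ j, (σ i).2 j ≤ n * N := by
    intro i
    induction i with
    | zero => exact fun _ => ⟨hσ.1, hsum⟩
    | succ i ih =>
      intro hi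
      obtain ⟨d, hd⟩ := hstep i hi
      exact ⟨V.tgt_mem _ hd.1, (hV.sum_step hd).trans_le (ih (by omega)).2⟩
  have hent : ∀ i ≤ m, ∀ x ∈ rank (σ i), x < B := fun i hi x hx => Nat.lt_succ_of_le <|
    (hA _ (hinv i hi).1 _ x hx).trans (Nat.mul_le_mul_left A (Nat.succ_le_succ (hinv i hi).2))
  have hdec : ∀ i ≤ m, lexCode B k (rank (σ i)) + i ≤ lexCode B k (rank (σ 0)) := by
    intro i
    induction i with
    | zero => exact fun _ => le_rfl
    | succ i ih =>
      intro hi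
      obtain ⟨d, hd⟩ := hstep i hi
      have h1 : lexCode B k (rank (σ (i + 1))) < lexCode B k (rank (σ i)) :=
        lexCode_lt_of_lexGT (hent (i + 1) hi) (hk _ (hinv i (by omega)).1 _)
        (hlex _ _ _ hd)
      have h2 := ih (by omega)
      omega
  have h1 := hdec m le_rfl
  have h2 := lexCode_lt (B := B) (Nat.succ_pos _) k (hent 0 (Nat.zero_le m))
  omega

theorem affineRank_step {V : VASS L n} {σ σ' : VState L n} {d : Fin n → ℤ} (h : V.Step σ d σ')
    (r : Fin n → ℕ) (z : L → ℕ) :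
    (affineRank r z σ' : ℤ) = affineRank r z σ + descent r z (σ.1, d, σ'.1) := by
  simp only [affineRank, descent, Transition.update, Transition.src, Transition.tgt]
  push_cast
  simp only [h.2, mul_add, Finset.sum_add_distrib]
  simp only [mul_comm (d _)]
  ring

theorem QuasiRankStage.step_le {V : VASS L n} {T : Finset (Transition L n)}
    {q : VState L n → ℕ} (h : V.QuasiRankStage T q) {σ σ' : VState L n} {d : Fin n → ℤ}
    (hs : V.Step σ d σ') : q σ' ≤ q σ := by
  obtain ⟨-, -, r, z, hrz, hq⟩ := h
  rw [hq, hq]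
  refine Finset.sum_le_sum fun t ht => ?_
  have h1 := affineRank_step hs (r t) (z t)
  have h2 : descent (r t) (z t) (σ.1, d, σ'.1) ≤ 0 := (hrz t ht).1 _ hs.1
  omega

theorem QuasiRankStage.step_lt {V : VASS L n} {T : Finset (Transition L n)}
    {q : VState L n → ℕ} (h : V.QuasiRankStage T q) {σ σ' : VState L n} {d : Fin n → ℤ}
    (hs : V.Step σ d σ') (hT : ((σ.1, d, σ'.1) : Transition L n) ∈ T) : q σ' < q σ := by
  obtain ⟨-, -, r, z, hrz, hq⟩ := h
  rw [hq, hq]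
  refine Finset.sum_lt_sum (fun t ht => ?_) ⟨_, hT, ?_⟩
  · have h1 := affineRank_step hs (r t) (z t)
    have h2 : descent (r t) (z t) (σ.1, d, σ'.1) ≤ 0 := (hrz t ht).1 _ hs.1
    omega
  · have h1 := affineRank_step hs (r (σ.1, d, σ'.1)) (z (σ.1, d, σ'.1))
    have h2 : descent (r (σ.1, d, σ'.1)) (z (σ.1, d, σ'.1)) (σ.1, d, σ'.1) < 0 := (hrz _ hT).2
    omega

variable [DecidableEq L]

/-- Induction on `Ranking` with the result index removed: only the terminating cases remain. -/
theorem Ranking.terminating_induction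
    {motive : VASS L n → (VState L n → List ℕ) → Prop}
    (nil : ∀ V, V.trns = ∅ → motive V fun _ => [])
    (cons : ∀ V T q, V.QuasiRankStage T q → ∀ rankS : VASS L n → VState L n → List ℕ,
      (∀ S : VASS L n, S.IsSCC (V.removeTrns T) → motive S (rankS S)) →
      ∀ rank, (∀ S : VASS L n, S.IsSCC (V.removeTrns T) → ∀ l ∈ S.locs, ∀ ν,
        rank (l, ν) = q (l, ν) :: rankS S (l, ν)) → motive V rank)
    {V : VASS L n} {rank : VState L n → List ℕ} (h : V.Ranking (.terminating rank)) :
    motive V rank := by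
  generalize hres : RankingResult.terminating rank = res at h
  induction h generalizing rank with
  | noTransitions V hV =>
    cases hres
    exact nil V hV
  | noDecrease | recNonterminating => cases hres
  | recTerminating V T q hT rankS hS rank' hrank ih =>
    cases hres
    exact cons V T q hT rankS (fun S hS => ih S hS rfl) _ hrank

theorem Ranking.isLexRanking {V : VASS L n} {rank : VState L n → List ℕ}
    (h : V.Ranking (.terminating rank)) : V.IsLexRanking rank := by
  refine terminating_induction (motive := fun V rank => V.IsLexRanking rank)
    (fun V hV σ d σ' hs => ?_) (fun V T q hT rankS ih rank hrank σ d σ' hs => ?_) h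
  · have := hs.1
    simp [hV] at this
  · obtain ⟨l, ν⟩ := σ
    obtain ⟨l', ν'⟩ := σ'
    have hl : l ∈ (V.removeTrns T).locs := V.src_mem _ hs.1
    have hl' : l' ∈ (V.removeTrns T).locs := V.tgt_mem _ hs.1
    by_cases ht : ((l, d, l') : Transition L n) ∈ T
    · rw [hrank _ (isSCC_sccOf hl) l (self_mem_sccOf hl),
        hrank _ (isSCC_sccOf hl') l' (self_mem_sccOf hl')]
      exact lexGT_cons.mpr (.inl (hT.step_lt hs ht))
    · have ht' : ((l, d, l') : Transition L n) ∈ (V.removeTrns T).trns :=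
        Finset.mem_sdiff.mpr ⟨hs.1, ht⟩
      have hm : (V.removeTrns T).mutualReach l l' := mutualReach_of_mem_removeTrns hT.1 ht'
      rw [hrank _ (isSCC_sccOf hl) l (self_mem_sccOf hl),
        hrank _ (isSCC_sccOf hl) l' (mem_sccOf_locs.mpr ⟨hl', hm⟩)]
      rcases (hT.step_le hs).lt_or_eq with h | h
      · exact lexGT_cons.mpr (.inl h)
      · exact lexGT_cons.mpr (.inr ⟨h.symm, ih _ (isSCC_sccOf hl) _ d _
          ⟨mem_sccOf_trns.mpr ⟨ht', Setoid.refl' _ _, hm⟩, hs.2⟩⟩)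

theorem Ranking.exists_entry_bound {V : VASS L n} {rank : VState L n → List ℕ}
    (h : V.Ranking (.terminating rank)) :
    ∃ A, ∀ l ∈ V.locs, ∀ ν, ∀ x ∈ rank (l, ν), x ≤ A * (∑ i, ν i + 1) := by
  refine terminating_induction (motive := fun V rank =>
    ∃ A, ∀ l ∈ V.locs, ∀ ν, ∀ x ∈ rank (l, ν), x ≤ A * (∑ i, ν i + 1))
    (fun V hV => ⟨0, by simp⟩) (fun V T q hT rankS ih rank hrank => ?_) h
  choose! A hA using ih
  obtain ⟨-, -, r, z, -, hq⟩ := hT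
  -- Summing the constants over locations covers every component; counting a component several times
  -- is harmless.
  refine ⟨∑ t ∈ T, (∑ i, r t i + ∑ l ∈ V.locs, z t l) +
    ∑ l ∈ V.locs, A ((V.removeTrns T).sccOf l), fun l hl ν x hx => ?_⟩
  have hl' : l ∈ (V.removeTrns T).locs := hl
  rw [hrank _ (isSCC_sccOf hl') l (self_mem_sccOf hl'), List.mem_cons] at hx
  rw [add_mul]
  rcases hx with rfl | hx
  · refine le_trans ?_ (Nat.le_add_right _ _)
    rw [hq, Finset.sum_mul]
    refine Finset.sum_le_sum fun t _ => ?_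
    rw [affineRank, add_mul]
    refine add_le_add ?_ ?_
    · rw [Finset.sum_mul]
      refine Finset.sum_le_sum fun i _ => Nat.mul_le_mul_left _ (Nat.le_succ_of_le ?_)
      exact Finset.single_le_sum (f := ν) (fun _ _ => Nat.zero_le _) (Finset.mem_univ i)
    · exact (Finset.single_le_sum (f := z t) (fun _ _ => Nat.zero_le _) hl).trans
        (Nat.le_mul_of_pos_right _ (Nat.succ_pos _))
  · refine le_trans ?_ (Nat.le_add_left _ _)
    refine (hA _ (isSCC_sccOf hl') l (self_mem_sccOf hl') ν x hx).trans
      (Nat.mul_le_mul_right _ ?_)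
    exact Finset.single_le_sum (f := fun l => A ((V.removeTrns T).sccOf l))
      (fun _ _ => Nat.zero_le _) hl

/-! ### The order is at most the dimension -/

theorem Circulation.of_isSub {S V : VASS L n} (hSV : S.trns ⊆ V.trns)
    {μ : Transition L n → ℕ} (h : S.Circulation μ) : V.Circulation μ := by
  have key : ∀ p : Transition L n → Prop, ∀ [DecidablePred p],
      ∑ t ∈ V.trns with p t, μ t = ∑ t ∈ S.trns with p t, μ t := by
    intro p _
    refine (Finset.sum_subset (Finset.filter_subset_filter p hSV) fun t ht ht' => h.1 t ?_).symm
    exact fun hc => ht' (Finset.mem_filter.mpr ⟨hc, (Finset.mem_filter.mp ht).2⟩)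
  exact ⟨fun t ht => h.1 t fun hc => ht (hSV hc), fun l => by rw [key, key, h.2 l]⟩

theorem Circulation.totalUpdate_of_isSub {S V : VASS L n} (hSV : S.trns ⊆ V.trns)
    {μ : Transition L n → ℕ} (h : S.Circulation μ) (i : Fin n) :
    V.totalUpdate μ i = S.totalUpdate μ i :=
  (Finset.sum_subset hSV fun t _ ht => by rw [h.1 t ht]; simp).symm

/-- The span of the effects of the circulations. -/
def cycleSpace (V : VASS L n) : Submodule ℚ (Fin n → ℚ) :=
  Submodule.span ℚ {v | ∃ μ, V.Circulation μ ∧ v = fun i => (V.totalUpdate μ i : ℚ)}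

/-- For a solution `(r, z)` of some `(B_t)` with `t ∈ T`, the form `r` maps the effect of a
circulation to its weighted sum of descents. Outside `T` the descents are zero, since a negative one
would put the transition into `T`; so `r` kills the smaller space. It is negative on a cycle through
`t`, which exists by connectedness. -/
theorem QuasiRankStage.cycleSpace_lt {V S : VASS L n} (hV : V.Connected)
    {T : Finset (Transition L n)} {q : VState L n → ℕ} (h : V.QuasiRankStage T q)
    (hS : S.IsSub (V.removeTrns T)) : S.cycleSpace < V.cycleSpace := by
  have hSV : S.trns ⊆ V.trns := hS.2.trans Finset.sdiff_subset
  obtain ⟨hT, ⟨t, ht⟩, -⟩ := h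
  obtain ⟨htV, r, z, hrz⟩ := (hT t).mp ht
  set φ : (Fin n → ℚ) →ₗ[ℚ] ℚ := ∑ i, (r i : ℚ) • LinearMap.proj i with hφ
  have hφμ : ∀ μ, V.Circulation μ → φ (fun i => (V.totalUpdate μ i : ℚ)) =
      ((∑ t' ∈ V.trns, (μ t' : ℤ) * descent r z t' : ℤ) : ℚ) := by
    intro μ hμ
    rw [hμ.sum_descent]
    simp [hφ, mul_comm]
  have hker : S.cycleSpace ≤ LinearMap.ker φ := by
    refine Submodule.span_le.mpr ?_
    rintro _ ⟨μ, hμ, rfl⟩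
    have := hφμ μ (hμ.of_isSub hSV)
    simp only [hμ.totalUpdate_of_isSub hSV] at this
    rw [SetLike.mem_coe, LinearMap.mem_ker, this, Int.cast_eq_zero]
    refine Finset.sum_eq_zero fun t' ht' => ?_
    by_cases hS' : t' ∈ S.trns
    · have h1 : descent r z t' ≤ 0 := hrz.1 t' ht'
      have h2 : ¬ descent r z t' < 0 := fun hc =>
        (Finset.mem_sdiff.mp (hS.2 hS')).2 ((hT t').mpr ⟨ht', r, z, hrz.1, hc⟩)
      rw [le_antisymm h1 (not_lt.mp h2), mul_zero]
    · rw [hμ.1 t' hS']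
      simp
  refine lt_of_le_of_ne ?_ fun he => ?_
  · refine Submodule.span_mono ?_
    rintro _ ⟨μ, hμ, rfl⟩
    exact ⟨μ, hμ.of_isSub hSV, funext fun i => by rw [hμ.totalUpdate_of_isSub hSV]⟩
  · obtain ⟨w, hw⟩ := (hV _ (V.tgt_mem t htV) _ (V.src_mem t htV)).exists_isWalk
    have hc : V.IsWalk t.src (t :: w) t.src := ⟨htV, rfl, hw⟩
    have h0 := hφμ _ hc.circulation
    have hmem : (fun i => (V.totalUpdate (fun s => (t :: w).count s) i : ℚ)) ∈ V.cycleSpace :=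
      Submodule.subset_span ⟨_, hc.circulation, rfl⟩
    rw [← he] at hmem
    rw [LinearMap.mem_ker.mp (hker hmem)] at h0
    have h1 : ∑ s ∈ V.trns, ((t :: w).count s : ℤ) * descent r z s < 0 :=
      Finset.sum_neg' (fun s hs => mul_nonpos_of_nonneg_of_nonpos (by positivity) (hrz.1 s hs))
        ⟨t, htV, mul_neg_of_pos_of_neg (by simp) hrz.2⟩
    rw [eq_comm, Int.cast_eq_zero] at h0
    exact h1.ne h0

theorem Ranking.length_le_finrank {V : VASS L n} {rank : VState L n → List ℕ}
    (h : V.Ranking (.terminating rank)) : V.Connected → ∀ l ∈ V.locs, ∀ ν,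
      (rank (l, ν)).length ≤ Module.finrank ℚ V.cycleSpace := by
  refine terminating_induction (motive := fun V rank => V.Connected → ∀ l ∈ V.locs, ∀ ν,
      (rank (l, ν)).length ≤ Module.finrank ℚ V.cycleSpace) (fun V _ _ _ _ _ => Nat.zero_le _)
      (fun V T q hT rankS ih rank hrank hV l hl ν => ?_) h
  have hl' : l ∈ (V.removeTrns T).locs := hl
  rw [hrank _ (isSCC_sccOf hl') l (self_mem_sccOf hl'), List.length_cons]
  exact (ih _ (isSCC_sccOf hl') (sccOf_connected _ l) l (self_mem_sccOf hl') ν).trans_lt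
    (Submodule.finrank_lt_finrank_of_lt (hT.cycleSpace_lt hV (sccOf_isSub _ l)))

theorem Ranking.length_le {V : VASS L n} {rank : VState L n → List ℕ}
    (h : V.Ranking (.terminating rank)) (hV : V.Connected) {l : L} (hl : l ∈ V.locs)
    (ν : Fin n → ℕ) : (rank (l, ν)).length ≤ n := by
  have := Submodule.finrank_le V.cycleSpace
  rw [Module.finrank_fin_fun] at this
  exact (h.length_le_finrank hV l hl ν).trans this

end VASS

/-! ### Long closed walks and the two bounds on the complexity -/

namespace VASS

variable {L : Type*} {n : ℕ}

theorem DropLE.mono {w : List (Transition L n)} {A B : ℕ} (h : DropLE w A) (hAB : A ≤ B) :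
    DropLE w B := fun u hu i => by
  have := h u hu i
  omega

theorem IsWalk.insert_all {V : VASS L n} {b : L} {w : List (Transition L n)}
    (h : V.IsWalk b w b) {A : ℕ} (hA : DropLE w A) (R : Finset L)
    (hR : ∀ x ∈ R, V.Visits b w x) {c : L → List (Transition L n)} {B : L → ℕ}
    (hc : ∀ x ∈ R, V.IsWalk x (c x) x) (hB : ∀ x ∈ R, DropLE (c x) (B x)) :
    ∃ w', V.IsWalk b w' b ∧ (∀ y, V.Visits b w y → V.Visits b w' y) ∧
      (∀ i, effect w' i = effect w i + ∑ x ∈ R, effect (c x) i) ∧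
      w'.length = w.length + ∑ x ∈ R, (c x).length ∧ DropLE w' (A + ∑ x ∈ R, B x) := by
  classical
  induction R using Finset.induction_on with
  | empty => exact ⟨w, h, fun _ => id, by simp, by simp, by simpa using hA⟩
  | insert y R hy ih =>
    obtain ⟨w', h1, h2, h3, h4, h5⟩ := ih (fun x hx => hR x (Finset.mem_insert_of_mem hx))
      (fun x hx => hc x (Finset.mem_insert_of_mem hx))
      (fun x hx => hB x (Finset.mem_insert_of_mem hx))
    have hyR := Finset.mem_insert_self y R
    obtain ⟨w'', h6, h7, h8, h9⟩ := h1.insert (h2 y (hR y hyR)) (hc y hyR)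
    refine ⟨w'', h6, fun x hx => h8 x (h2 x hx), fun i => ?_, ?_, ?_⟩
    · rw [effect_eq_of_perm h7, effect_append, h3, Finset.sum_insert hy]
      ring
    · rw [h7.length_eq, List.length_append, h4, Finset.sum_insert hy]
      ring
    · refine (h9 _ _ h5 (hB y hyR)).mono ?_
      rw [Finset.sum_insert hy]
      omega

/-- A choice of a representative location of every strongly connected component. -/
noncomputable def sccRep (V : VASS L n) (x : L) : L := (Quotient.mk V.mutualReach x).out

theorem mutualReach_sccRep (V : VASS L n) (x : L) : V.mutualReach x (V.sccRep x) :=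
  V.mutualReach.symm (Quotient.mk_out (s := V.mutualReach) x)

theorem sccRep_eq {V : VASS L n} {x y : L} (h : V.mutualReach x y) : V.sccRep x = V.sccRep y :=
  congrArg Quotient.out (Quotient.sound (s := V.mutualReach) h)

theorem le_comp {V : VASS L n} {N m : ℕ} {σ : VState L n} (hσ : V.IsBoundedState N σ)
    (h : V.HasTrace σ m) : (m : ℕ∞) ≤ V.comp N :=
  le_sSup ⟨σ, m, rfl, hσ, h⟩

theorem HasOrder.exists_length_eq {V : VASS L n} {rank : VState L n → List ℕ} {k : ℕ}
    (h : V.HasOrder rank k) (hk : 1 ≤ k) : ∃ l ∈ V.locs, ∃ ν, (rank (l, ν)).length = k := by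
  -- For `k = 0` the claim could fail: a system without locations has order `0`.
  by_contra hc
  push Not at hc
  have : k ≤ k - 1 := h.2 fun l hl ν =>
    Nat.le_sub_one_of_lt (lt_of_le_of_ne (h.1 l hl ν) (hc l hl ν))
  omega

variable [DecidableEq L]

/-- A circulation supported on the transitions of a system whose transitions stay within their
components restricts to the components. -/
theorem Circulation.restrict_sccOf {V V' : VASS L n} {μ : Transition L n → ℕ}
    (h : V.Circulation μ) (hsub : V'.IsSub V) (hsupp : ∀ t, μ t ≠ 0 → t ∈ V'.trns)
    (hV' : ∀ t ∈ V'.trns, V'.mutualReach t.src t.tgt) (x : L) :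
    (V'.sccOf x).Circulation (fun t => open Classical in
      if t ∈ (V'.sccOf x).trns then μ t else 0) := by
  classical
  refine ⟨fun t ht => if_neg ht, fun y => ?_⟩
  have hS : (V'.sccOf x).trns ⊆ V.trns := (sccOf_isSub V' x).2.trans hsub.2
  have key : ∀ f : Transition L n → L, (∀ t ∈ (V'.sccOf x).trns, V'.mutualReach x (f t)) →
      (∀ t ∈ V'.trns, V'.mutualReach x (f t) → t ∈ (V'.sccOf x).trns) →
      ∑ t ∈ (V'.sccOf x).trns with f t = y, (if t ∈ (V'.sccOf x).trns then μ t else 0) =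
        if V'.mutualReach x y then ∑ t ∈ V.trns with f t = y, μ t else 0 := by
    intro f hf hf'
    split_ifs with hy
    · rw [← Finset.sum_subset (Finset.filter_subset_filter (fun t => f t = y) hS)]
      · exact Finset.sum_congr rfl fun t ht => if_pos (Finset.mem_filter.mp ht).1
      · intro t ht ht'
        obtain ⟨-, rfl⟩ := Finset.mem_filter.mp ht
        by_contra hc
        exact ht' (Finset.mem_filter.mpr ⟨hf' t (hsupp t hc) hy, rfl⟩)
    · refine Finset.sum_eq_zero fun t ht => ?_
      obtain ⟨htS, rfl⟩ := Finset.mem_filter.mp ht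
      exact absurd (hf t htS) hy
  rw [key _ (fun t ht => (mem_sccOf_trns.mp ht).2.2), key _ (fun t ht => (mem_sccOf_trns.mp ht).2.1),
    h.2 y]
  · exact fun t ht hx => mem_sccOf_trns.mpr ⟨ht, hx, V'.mutualReach.trans hx (hV' t ht)⟩
  · exact fun t ht hx => mem_sccOf_trns.mpr
      ⟨ht, V'.mutualReach.trans hx (V'.mutualReach.symm (hV' t ht)), hx⟩

/-- The components, indexed by their representatives, partition the transitions of `V'`. -/
theorem sum_totalUpdate_sccOf {V V' : VASS L n} {μ : Transition L n → ℕ} (hsub : V'.IsSub V)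
    (hsupp : ∀ t, μ t ≠ 0 → t ∈ V'.trns)
    (hV' : ∀ t ∈ V'.trns, V'.mutualReach t.src t.tgt) (i : Fin n) :
    ∑ x ∈ V'.locs.image V'.sccRep, (V'.sccOf x).totalUpdate μ i = V.totalUpdate μ i := by
  have h1 : V.totalUpdate μ i = ∑ t ∈ V'.trns, t.update i * (μ t : ℤ) := by
    refine (Finset.sum_subset hsub.2 fun t _ ht => ?_).symm
    rw [show μ t = 0 from by_contra fun hc => ht (hsupp t hc)]
    simp
  rw [h1, ← Finset.sum_fiberwise_of_maps_to (t := V'.locs.image V'.sccRep)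
    (g := fun t => V'.sccRep t.src) fun t ht => Finset.mem_image_of_mem _ (V'.src_mem t ht)]
  refine Finset.sum_congr rfl fun x hx => ?_
  obtain ⟨y, -, rfl⟩ := Finset.mem_image.mp hx
  refine Finset.sum_congr ?_ fun _ _ => rfl
  ext t
  rw [mem_sccOf_trns, Finset.mem_filter]
  constructor
  · rintro ⟨ht, h, -⟩
    exact ⟨ht, (sccRep_eq (V'.mutualReach.trans (V'.mutualReach_sccRep y) h)).symm⟩
  · rintro ⟨ht, h⟩
    have := V'.mutualReach.symm (h ▸ V'.mutualReach_sccRep t.src)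
    exact ⟨ht, this, V'.mutualReach.trans this (hV' t ht)⟩

/-- The sum of solutions of `(A_t)` over all `t` outside `T`; each has zero total update by
conservativity. -/
theorem QuasiRankStage.exists_zero_circulation {V : VASS L n} (hV : V.Conservative)
    {T : Finset (Transition L n)} {q : VState L n → ℕ} (h : V.QuasiRankStage T q) :
    ∃ μ, V.Circulation μ ∧ (∀ t, μ t ≠ 0 → t ∈ (V.removeTrns T).trns) ∧
      (∀ t ∈ (V.removeTrns T).trns, 1 ≤ μ t) ∧ ∀ i, V.totalUpdate μ i = 0 := by
  have hex : ∀ t, t ∈ (V.removeTrns T).trns →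
      ∃ μ, V.SolvesA t μ ∧ ∀ t', μ t' ≠ 0 → t' ∈ (V.removeTrns T).trns :=
    fun t ht => exists_solvesA_support h.1 ht
  choose! μ hμ hs using hex
  refine ⟨fun t => ∑ s ∈ (V.removeTrns T).trns, μ s t,
    Circulation.sum _ fun s hs => (hμ s hs).circulation, fun t ht => ?_, fun t ht => ?_,
    fun i => ?_⟩
  · obtain ⟨s, hs1, hs2⟩ := Finset.exists_ne_zero_of_sum_ne_zero ht
    exact hs s hs1 t hs2
  · exact (hμ t ht).2.2.2.trans (Finset.single_le_sum (f := fun s => μ s t)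
      (fun _ _ => Nat.zero_le _) ht)
  · rw [totalUpdate_sum]
    exact Finset.sum_eq_zero fun s hs => (hμ s hs).totalUpdate_eq_zero hV i

/-- For a conservative system with a ranking function, any circulation of full support can be
executed `N` times by a closed walk that loses `O(N)` in every coordinate on the way and has length
of order `N ^ k`, where `k` is the length of the value of the ranking function at any state. -/
theorem Ranking.exists_long_walk {V : VASS L n} {rank : VState L n → List ℕ}
    (h : V.Ranking (.terminating rank)) :
    V.Connected → V.Conservative → ∀ m, V.Circulation m → (∀ t ∈ V.trns, 1 ≤ m t) →
      ∀ b ∈ V.locs, ∀ l ∈ V.locs, ∀ ν, ∃ C, ∀ N : ℕ, ∃ w, V.IsWalk b w b ∧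
        (∀ i, effect w i = N * V.totalUpdate m i) ∧ DropLE w (C * N) ∧
        N ^ (rank (l, ν)).length ≤ w.length + 1 := by
  classical
  refine terminating_induction (motive := fun V rank =>
    V.Connected → V.Conservative → ∀ m, V.Circulation m → (∀ t ∈ V.trns, 1 ≤ m t) →
      ∀ b ∈ V.locs, ∀ l ∈ V.locs, ∀ ν, ∃ C, ∀ N : ℕ, ∃ w, V.IsWalk b w b ∧
        (∀ i, effect w i = N * V.totalUpdate m i) ∧ DropLE w (C * N) ∧
        N ^ (rank (l, ν)).length ≤ w.length + 1)
    (fun V hV _ _ m _ _ b _ l _ ν => ⟨0, fun N => ⟨[], rfl, by simp [totalUpdate, hV],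
      fun u hu i => by simp [List.prefix_nil.mp hu], by simp⟩⟩)
    (fun V T q hT rankS ih rank hrank hconn hcons m hm hfull b hb l hl ν => ?_) h
  set V' := V.removeTrns T with hV'def
  have hsub : V'.IsSub V := ⟨subset_rfl, Finset.sdiff_subset⟩
  have hmut : ∀ t ∈ V'.trns, V'.mutualReach t.src t.tgt := fun t ht =>
    mutualReach_of_mem_removeTrns hT.1 ht
  obtain ⟨μ, hμ, hsupp, hpos, hzero⟩ := hT.exists_zero_circulation hcons
  -- The restriction of `μ` to one component may have nonzero effect, which is why the induction
  -- allows an arbitrary circulation `m`. The length matters only in the component of `l`; elsewhere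
  -- `x` serves as a dummy location.
  have hinner : ∀ x ∈ V.locs, ∃ C, ∀ N : ℕ, ∃ c, V.IsWalk x c x ∧
      (∀ i, effect c i = N * (V'.sccOf x).totalUpdate μ i) ∧ DropLE c (C * N) ∧
      (V'.mutualReach x l → N ^ (rankS (V'.sccOf l) (l, ν)).length ≤ c.length + 1) := by
    intro x hx
    have hx' : x ∈ V'.locs := hx
    have hSV : (V'.sccOf x).IsSub V :=
      ⟨(sccOf_isSub V' x).1.trans hsub.1, (sccOf_isSub V' x).2.trans hsub.2⟩
    obtain ⟨C, hC⟩ := ih _ (isSCC_sccOf hx') (sccOf_connected V' x)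
      (fun t ht => hcons t (hSV.2 ht)) _ (hμ.restrict_sccOf hsub hsupp hmut x)
      (fun t ht => by simp only [if_pos ht]; exact hpos t (mem_sccOf_trns.mp ht).1)
      x (self_mem_sccOf hx') (if V'.mutualReach x l then l else x)
      (by split_ifs with hxl
          · exact mem_sccOf_locs.mpr ⟨hl, hxl⟩
          · exact self_mem_sccOf hx') ν
    refine ⟨C, fun N => ?_⟩
    obtain ⟨c, h1, h2, h3, h4⟩ := hC N
    refine ⟨c, h1.mono hSV.2, fun i => ?_, h3, fun hxl => ?_⟩
    · rw [h2]
      congr 1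
      exact Finset.sum_congr rfl fun t ht => by simp only [if_pos ht]
    · rw [if_pos hxl] at h4
      rwa [(isSCC_sccOf hx').eq_sccOf (mem_sccOf_locs.mpr ⟨hl, hxl⟩)]
  choose! C hC using hinner
  obtain ⟨W, hW, hWm⟩ := hm.exists_eulerian hconn hfull hb
  obtain ⟨A, hA⟩ := exists_dropLE W
  have hWeff : ∀ i, effect W i = V.totalUpdate m i := fun i => by
    rw [← hW.totalUpdate_count, funext hWm]
  have hWpos : 1 ≤ W.length := by
    obtain ⟨t, ht⟩ := hT.2.1
    have := hfull t ((hT.1 t).mp ht).1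
    rw [← hWm t] at this
    exact this.trans List.count_le_length
  have hvis : ∀ x ∈ V.locs, V.Visits b W x := fun x hx => hW.visits_all hconn hb
    (fun t ht _ => List.count_pos_iff.mp (by rw [hWm]; exact hfull t ht)) hx
  set R := V'.locs.image V'.sccRep with hR
  have hRV : ∀ x ∈ R, x ∈ V.locs := by
    intro x hx
    obtain ⟨y, hy, rfl⟩ := Finset.mem_image.mp hx
    exact (V'.mutualReach_sccRep y).1.mem_locs hy
  have hl' : l ∈ V'.locs := hl
  -- One `A` pays for the net loss of the `N` rounds, the other for the drop of `W` within a round,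
  -- using `A ≤ A * N`; the latter is why `N = 0` is treated apart.
  refine ⟨2 * A + ∑ x ∈ R, C x, fun N => ?_⟩
  rw [hrank _ (isSCC_sccOf hl') l (self_mem_sccOf hl'), List.length_cons]
  rcases N.eq_zero_or_pos with rfl | hN
  · exact ⟨[], rfl, by simp, fun u hu i => by simp [List.prefix_nil.mp hu], by simp⟩
  have hCN := fun x hx => hC x hx N
  choose! c hc1 hc2 hc3 hc4 using hCN
  obtain ⟨w, h1, -, h2, h3, h4⟩ := hW.insert_all hA R (fun x hx => hvis x (hRV x hx))
    (fun x hx => hc1 x (hRV x hx)) (fun x hx => hc3 x (hRV x hx))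
  -- The effects inserted in the various components cancel, because `μ` has total effect zero.
  have hweff : ∀ i, effect w i = V.totalUpdate m i := fun i => by
    rw [h2, hWeff, Finset.sum_congr rfl fun x hx => hc2 x (hRV x hx) i, ← Finset.mul_sum,
      sum_totalUpdate_sccOf hsub hsupp hmut, hzero, mul_zero, add_zero]
  -- The nonempty walk `W` absorbs the `+ 1` of the inner length bound.
  have hwlen : N ^ (rankS (V'.sccOf l) (l, ν)).length ≤ w.length := by
    have hrep : V'.sccRep l ∈ R := Finset.mem_image_of_mem _ hl'
    have h5 := hc4 _ (hRV _ hrep) (V'.mutualReach.symm (V'.mutualReach_sccRep l))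
    have h6 : (c (V'.sccRep l)).length ≤ ∑ x ∈ R, (c x).length :=
      Finset.single_le_sum (f := fun x => (c x).length) (fun _ _ => Nat.zero_le _) hrep
    omega
  obtain ⟨w', h5, h6, h7, h8⟩ := h1.iterate (A := A) (fun i => by
    rw [hweff, ← hWeff]
    exact hA W List.prefix_rfl i) h4 N
  refine ⟨w', h5, fun i => by rw [h6, hweff], h7.mono ?_, ?_⟩
  · rw [← Finset.sum_mul]
    have : A ≤ A * N := Nat.le_mul_of_pos_right A hN
    calc _ ≤ N * A + (A * N + (∑ x ∈ R, C x) * N) := by gcongr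
      _ = _ := by ring
  · rw [h8, pow_succ']
    exact (Nat.mul_le_mul_left N hwlen).trans (Nat.le_succ _)

theorem Connected.exists_circulation {V : VASS L n} (hV : V.Connected) :
    ∃ m, V.Circulation m ∧ ∀ t ∈ V.trns, 1 ≤ m t := by
  have hex : ∀ t, t ∈ V.trns → ∃ w, V.IsWalk t.tgt w t.src := fun t ht =>
    (hV _ (V.tgt_mem t ht) _ (V.src_mem t ht)).exists_isWalk
  choose! w hw using hex
  have hc : ∀ t ∈ V.trns, V.IsWalk t.src (t :: w t) t.src := fun t ht => ⟨ht, rfl, hw t ht⟩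
  refine ⟨_, Circulation.sum V.trns fun t ht => (hc t ht).circulation, fun t ht => ?_⟩
  exact le_trans (by simp) (Finset.single_le_sum (f := fun s => (s :: w s).count t)
    (fun _ _ => Nat.zero_le _) ht)

/-- From `N` in every coordinate, the long walk with parameter `N / (C + 1)` drops by at most `N`
and is therefore a trace. -/
theorem Ranking.exists_pow_le_comp {V : VASS L n} {rank : VState L n → List ℕ}
    (h : V.Ranking (.terminating rank)) (hconn : V.Connected) (hcons : V.Conservative)
    {l : L} (hl : l ∈ V.locs) (ν : Fin n → ℕ) :
    ∃ C : ℕ, ∀ N : ℕ, (((N / (C + 1)) ^ (rank (l, ν)).length : ℕ) : ℕ∞) ≤ V.comp N + 1 := by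
  obtain ⟨m, hm, hfull⟩ := hconn.exists_circulation
  obtain ⟨C, hC⟩ := h.exists_long_walk hconn hcons m hm hfull l hl l hl ν
  refine ⟨C, fun N => ?_⟩
  obtain ⟨w, hw, -, hdrop, hlen⟩ := hC (N / (C + 1))
  have hle : C * (N / (C + 1)) ≤ N :=
    (Nat.mul_le_mul_right _ (Nat.le_succ C)).trans (Nat.mul_div_le N (C + 1))
  have htr : V.HasTrace (l, fun _ => N) w.length := hw.hasTrace fun u hu i => by
    have := hdrop.mono hle u hu i
    linarith
  calc _ ≤ ((w.length + 1 : ℕ) : ℕ∞) := by exact_mod_cast hlen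
    _ ≤ _ := by
      push_cast
      gcongr
      exact le_comp ⟨hl, fun _ => le_rfl⟩ htr

/-- The `- 1` is kept so that `k = 0` gives complexity zero. -/
theorem Ranking.exists_comp_le {V : VASS L n} {rank : VState L n → List ℕ}
    (h : V.Ranking (.terminating rank)) (hcons : V.Conservative) {k : ℕ}
    (hk : V.HasOrder rank k) :
    ∃ A : ℕ, ∀ N : ℕ, V.comp N ≤ (((A * (n * N + 1) + 1) ^ k - 1 : ℕ) : ℕ∞) := by
  obtain ⟨A, hA⟩ := h.exists_entry_bound
  refine ⟨A, fun N => sSup_le ?_⟩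
  rintro _ ⟨σ, m, rfl, hσ, htr⟩
  have := hcons.lt_of_hasTrace h.isLexRanking hA hk.1 hσ htr
  exact_mod_cast Nat.le_sub_one_of_lt this

theorem isTheta_pow_of_bounds {f : ℕ → ℕ} {k A C n : ℕ} (hk : 1 ≤ k)
    (hu : ∀ N, f N ≤ (A * (n * N + 1) + 1) ^ k) (hl : ∀ N, (N / (C + 1)) ^ k ≤ f N + 1) :
    (fun N : ℕ => (f N : ℝ)) =Θ[atTop] fun N : ℕ => (N : ℝ) ^ k := by
  refine ⟨IsBigO.of_bound (((A * n + A + 1) ^ k : ℕ) : ℝ) ?_,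
    IsBigO.of_bound ((2 * (2 * (C + 1)) ^ k : ℕ) : ℝ) ?_⟩
  · filter_upwards [eventually_ge_atTop 1] with N hN
    rw [Real.norm_of_nonneg (by positivity), Real.norm_of_nonneg (by positivity)]
    have : f N ≤ (A * n + A + 1) ^ k * N ^ k := by
      rw [← mul_pow]
      refine (hu N).trans (Nat.pow_le_pow_left ?_ k)
      have : A ≤ A * N := Nat.le_mul_of_pos_right A hN
      calc A * (n * N + 1) + 1 = A * n * N + A + 1 := by ring
        _ ≤ A * n * N + A * N + N := by omega
        _ = _ := by ring
    exact_mod_cast this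
  · filter_upwards [eventually_ge_atTop (2 * (C + 1))] with N hN
    rw [Real.norm_of_nonneg (by positivity), Real.norm_of_nonneg (by positivity)]
    set M := N / (C + 1) with hM
    -- With `M ≥ 2` and `k ≥ 1` the bound `M ^ k ≤ f N + 1` improves to `M ^ k ≤ 2 * f N`.
    have hM2 : 2 ≤ M := (Nat.le_div_iff_mul_le (Nat.succ_pos C)).mpr hN
    have hMk : 2 ≤ M ^ k := hM2.trans (Nat.le_self_pow (by omega) M)
    have hNM : N ≤ 2 * (C + 1) * M := by
      have h1 := Nat.lt_mul_div_succ N (Nat.succ_pos C)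
      rw [Nat.succ_eq_add_one, ← hM] at h1
      nlinarith
    have hlN : M ^ k ≤ f N + 1 := hl N
    have : N ^ k ≤ 2 * (2 * (C + 1)) ^ k * f N := by
      calc N ^ k ≤ (2 * (C + 1) * M) ^ k := Nat.pow_le_pow_left hNM k
        _ = (2 * (C + 1)) ^ k * M ^ k := mul_pow _ _ _
        _ ≤ (2 * (C + 1)) ^ k * (2 * f N) := Nat.mul_le_mul_left _ (by omega)
        _ = _ := by ring
    exact_mod_cast this

theorem Ranking.complexity {V : VASS L n} (hconn : V.Connected) (hcons : V.Conservative)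
    {rank : VState L n → List ℕ} {k : ℕ} (h : V.Ranking (.terminating rank))
    (hk : V.HasOrder rank k) :
    k ≤ n ∧ (∀ N, V.comp N ≠ ⊤) ∧
      (1 ≤ k → (fun N : ℕ => ((V.comp N).toNat : ℝ)) =Θ[atTop] fun N : ℕ => (N : ℝ) ^ k) ∧
      (k = 0 → ∀ N, V.comp N = 0) := by
  obtain ⟨A, hA⟩ := h.exists_comp_le hcons hk
  have hfin : ∀ N, V.comp N ≠ ⊤ := fun N => ne_top_of_le_ne_top (ENat.natCast_ne_top _) (hA N)
  refine ⟨hk.2 fun l hl ν => h.length_le hconn hl ν, hfin, fun hk1 => ?_, fun hk0 N => ?_⟩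
  · obtain ⟨l, hl, ν, hlen⟩ := hk.exists_length_eq hk1
    obtain ⟨C, hC⟩ := h.exists_pow_le_comp hconn hcons hl ν
    rw [hlen] at hC
    refine isTheta_pow_of_bounds (A := A) (C := C) (n := n) hk1 (fun N => ?_) fun N => ?_
    · have := hA N
      rw [← ENat.natCast_toNat (hfin N), Nat.cast_le] at this
      exact this.trans (Nat.sub_le _ _)
    · have := hC N
      rw [← ENat.natCast_toNat (hfin N)] at this
      exact_mod_cast this
  · have := hA N
    rw [hk0] at this
    simpa using this

end VASS

theorem mainTheorem7 {L : Type*} [DecidableEq L] {n : ℕ} (V : VASS L n)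
    (hconn : V.Connected) (hcons : V.Conservative) :
    (∀ (rank : VState L n → List ℕ) (k : ℕ),
      V.Ranking (.terminating rank) → V.HasOrder rank k →
        V.IsLexRanking rank ∧ k ≤ n ∧ (∀ N, V.comp N ≠ ⊤) ∧
        (1 ≤ k → (fun N : ℕ => ((V.comp N).toNat : ℝ)) =Θ[atTop] fun N : ℕ => (N : ℝ) ^ k) ∧
        (k = 0 → ∀ N, V.comp N = 0)) ∧
    (V.Terminating →
      ∃ k ≤ n,
        (∃ rank : VState L n → List ℕ, V.Ranking (.terminating rank) ∧ V.HasOrder rank k) ∧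
        (∀ N, V.comp N ≠ ⊤) ∧
        (1 ≤ k → (fun N : ℕ => ((V.comp N).toNat : ℝ)) =Θ[atTop] fun N : ℕ => (N : ℝ) ^ k) ∧
        (k = 0 → ∀ N, V.comp N = 0)) := by
  refine ⟨fun rank k h hk => ⟨h.isLexRanking, h.complexity hconn hcons hk⟩, fun hterm => ?_⟩
  rcases V.exists_ranking with ⟨rank, h⟩ | ⟨w, h⟩
  · have hk : V.HasOrder rank (sInf {j | ∀ l ∈ V.locs, ∀ ν, (rank (l, ν)).length ≤ j}) :=
      ⟨Nat.sInf_mem ⟨n, fun l hl ν => h.length_le hconn hl ν⟩, fun _ hj => Nat.sInf_le hj⟩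
    obtain ⟨h1, h2⟩ := h.complexity hconn hcons hk
    exact ⟨_, h1, ⟨rank, h, hk⟩, h2⟩
  · exact absurd hterm (h.not_terminating rfl hconn)
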